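/- Work in propositional intuitionistic linear logic with connectives $\otimes, \&, \multimap, {!}$, and write $\sim$ for equivalence of proofs under cut-elimination. Let $k$ be an algebraically closed field of characteristic zero (for instance $k=\mathbb{C}$) and let $[\![-]\!]$ be the Sweedler semantics of linear logic in $k$-vector spaces, determined by an arbitrary choice of vector spaces for the atomic formulas: $[\![A\otimes B]\!]=[\![A]\!]\otimes[\![B]\!]$, $[\![A\,\&\,B]\!]=[\![A]\!]\oplus[\![B]\!]$, $[\![A\multimap B]\!]=\operatorname{Hom}_k([\![A]\!],[\![B]\!])$ and $[\![{!}A]\!]={!}[\![A]\!]$, where ${!}V=\bigoplus_{P\in V}\operatorname{Sym}_P(V)$ is the cofree cocommutative coalgebra on $V$, with universal map $d:{!}V\to V$. The vector $v_1\cdots v_s$ of $\operatorname{Sym}_P(V)=\operatorname{Sym}(V)$ is denoted $|v_1,\dots,v_s\rangle_P$; thus $d|\emptyset\rangle_P=P$, $d|v\rangle_P=v$, and $d|v_1,\dots,v_s\rangle_P=0$ for $s>1$. A proof $\rho$ of $\vdash A$ is identified with a vector $[\![\rho]\!]\in[\![A]\!]$. Let $n\ge 0$ and let $\psi$ be a plain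 proof of ${!}A\vdash B$ of degree $n$ with linear part $\pi$. That is, $\pi$ is a proof of $A,\dots,A\vdash B$ ($n$ copies of $A$) that does not use the rules for ${!}$, and $\psi$ is equivalent under cut-elimination to a proof of ${!}A\vdash B$ obtained from $\pi$ by derelicting all hypotheses and then contracting them (weakening if $n=0$). Let $0$ and $1$ be two proofs of $\vdash A$. For proofs $X_1,\dots,X_n$ of $\vdash A$, write $\pi(X_1,\dots,X_n)$ for the cut of $\pi$ against $X_1,\dots,X_n$, and write $\psi(0)$ for the cut of $\psi$ against the promotion of the proof $0$. Let $\mathcal{Q}$ be a finite set of pairwise inequivalent proofs of $\vdash B$ such that for all $X_1,\dots,X_n\in\{0,1\}$ the proof $\pi(X_1,\dots,X_n)$ is equivalent under cut-elimination to an element of $\mathcal{Q}$. (In particular, this allows any finite $\mathcal Q$ with this last property for which $\{[\![\nu]\!]\}_{\nu\in\mathcal{Q}}$ is linearly independent.) Then $$[\![\psi]\!]\,\big|[\![1]\!]-[\![0]\!]\big\rangle_{[\![0]\!]}=\sum_{\tau\in\mathcal{Q},\ \tau\not\sim\psi(0)}A_\tau\,\big([\![\tau]\!]-[\![\psi(0)]\!]\big),$$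 where $A_\tau$ is the number of $i\in\{1,\dots,n\}$ such that $\pi(0,\dots,0,1,0,\dots,0)\sim\tau$, with the $1$ in the $i$-th position. In other words, $A_\tau$ is the number of weight one error syndromes that produce $\tau$. -/

import Mathlib

open scoped TensorProduct

/-!
Propositional intuitionistic linear logic with the connectives `⊗`, `&`, `⊸`, `!`: formulas,
sequent calculus proofs, equivalence of proofs under cut-elimination, plain proofs, and the Sweedler
semantics in vector spaces, where `!V` is the cofree cocommutative coalgebra `⨁_{P ∈ V} Sym_P(V)`.
-/

universe u w

namespace LinLog

/-! ### Formulas, contexts and exchanges -/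

/-- Formulas over a type `α` of atomic formulas. -/
inductive Formula (α : Type w) : Type w
  | atom (a : α) : Formula α
  | tensor (A B : Formula α) : Formula α
  | conj (A B : Formula α) : Formula α
  | limp (A B : Formula α) : Formula α
  | bang (A : Formula α) : Formula α

/-- Contexts (the left hand sides of sequents): finite sequences of formulas, kept with a
bracketing. Bracketing and order are immaterial, they are changed by the exchange rule. -/
inductive Ctx (α : Type w) : Type w
  | nil : Ctx α
  | single (A : Formula α) : Ctx α
  | join (Γ Δ : Ctx α) : Ctx α

infixr:65 " ⨾ " => Ctx.join

variable {α : Type w}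

/-- The context `A, Γ`. -/
abbrev Ctx.cons (A : Formula α) (Γ : Ctx α) : Ctx α := Ctx.single A ⨾ Γ

infixr:66 " ∷ " => Ctx.cons

/-- The context `!Γ`. -/
def Ctx.bang : Ctx α → Ctx α
  | .nil => .nil
  | .single A => .single A.bang
  | .join Γ Δ => Γ.bang ⨾ Δ.bang

/-- The context `n A`, that is, `A, …, A` with `n` copies of `A`. -/
def Ctx.rep (A : Formula α) : ℕ → Ctx α
  | 0 => .nil
  | n + 1 => A ∷ Ctx.rep A n

/-- The positions of (occurrences of formulas in) a context. -/
def Ctx.Pos : Ctx α → Type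
  | .nil => Empty
  | .single _ => Unit
  | .join Γ Δ => Γ.Pos ⊕ Δ.Pos

/-- Exchanges: ways of reordering and rebracketing a context. -/
inductive Exch : Ctx α → Ctx α → Type w
  | refl (Γ : Ctx α) : Exch Γ Γ
  | symm {Γ Δ : Ctx α} (e : Exch Γ Δ) : Exch Δ Γ
  | trans {Γ Δ Θ : Ctx α} (e : Exch Γ Δ) (f : Exch Δ Θ) : Exch Γ Θ
  | join {Γ Γ' Δ Δ' : Ctx α} (e : Exch Γ Γ') (f : Exch Δ Δ') : Exch (Γ ⨾ Δ) (Γ' ⨾ Δ')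
  | comm (Γ Δ : Ctx α) : Exch (Γ ⨾ Δ) (Δ ⨾ Γ)
  | assoc (Γ Δ Θ : Ctx α) : Exch ((Γ ⨾ Δ) ⨾ Θ) (Γ ⨾ (Δ ⨾ Θ))
  | unit (Γ : Ctx α) : Exch (.nil ⨾ Γ) Γ

namespace Exch

/-- The permutation of positions underlying an exchange. -/
def perm : {Γ Δ : Ctx α} → Exch Γ Δ → (Γ.Pos ≃ Δ.Pos)
  | _, _, refl _ => Equiv.refl _
  | _, _, symm e => e.perm.symm
  | _, _, trans e f => e.perm.trans f.perm
  | _, _, join e f => Equiv.sumCongr e.perm f.perm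
  | _, _, comm _ _ => Equiv.sumComm _ _
  | _, _, assoc _ _ _ => Equiv.sumAssoc _ _ _
  | _, _, unit Γ => Equiv.emptySum Empty Γ.Pos

/-- An exchange `Γ → Δ` gives an exchange `!Γ → !Δ`. -/
def bang : {Γ Δ : Ctx α} → Exch Γ Δ → Exch Γ.bang Δ.bang
  | _, _, refl _ => refl _
  | _, _, symm e => e.bang.symm
  | _, _, trans e f => e.bang.trans f.bang
  | _, _, join e f => e.bang.join f.bang
  | _, _, comm Γ Δ => comm Γ.bang Δ.bang
  | _, _, assoc Γ Δ Θ => assoc Γ.bang Δ.bang Θ.bang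
  | _, _, unit Γ => unit Γ.bang

/-- `Γ, ∅ → Γ`. -/
def runit (Γ : Ctx α) : Exch (Γ ⨾ .nil) Γ := (comm Γ .nil).trans (unit Γ)

/-- `Γ, Δ, Θ → Δ, Γ, Θ`. -/
def lcomm (Γ Δ Θ : Ctx α) : Exch (Γ ⨾ (Δ ⨾ Θ)) (Δ ⨾ (Γ ⨾ Θ)) :=
  ((assoc Γ Δ Θ).symm.trans ((comm Γ Δ).join (refl Θ))).trans (assoc Δ Γ Θ)

/-- `Γ, Δ, Θ, Λ → Θ, Γ, Δ, Λ`. -/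
def lcomm₂ (Γ Δ Θ Λ : Ctx α) : Exch (Γ ⨾ (Δ ⨾ (Θ ⨾ Λ))) (Θ ⨾ (Γ ⨾ (Δ ⨾ Λ))) :=
  ((refl Γ).join (lcomm Δ Θ Λ)).trans (lcomm Γ Θ (Δ ⨾ Λ))

/-- Rebracketing `((Γ, Δ, Θ), Λ)` to `Γ, Δ, (Θ, Λ)`. -/
def assoc₂ (Γ Δ Θ Λ : Ctx α) : Exch ((Γ ⨾ (Δ ⨾ Θ)) ⨾ Λ) (Γ ⨾ (Δ ⨾ (Θ ⨾ Λ))) :=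
  (assoc Γ (Δ ⨾ Θ) Λ).trans ((refl Γ).join (assoc Δ Θ Λ))

end Exch

/-! ### Proofs -/

/-- Proofs of the sequent `Γ ⊢ A`. -/
inductive Proof : Ctx α → Formula α → Type w
  | ax (A : Formula α) : Proof (.single A) A
  | exch {Γ Δ : Ctx α} {A : Formula α} (e : Exch Γ Δ) (p : Proof Γ A) : Proof Δ A
  | cut {Γ Δ : Ctx α} {A B : Formula α} (p : Proof Γ A) (q : Proof (A ∷ Δ) B) : Proof (Γ ⨾ Δ) B
  | tensorR {Γ Δ : Ctx α} {A B : Formula α} (p : Proof Γ A) (q : Proof Δ B) :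
      Proof (Γ ⨾ Δ) (A.tensor B)
  | tensorL {Γ : Ctx α} {A B C : Formula α} (p : Proof (A ∷ B ∷ Γ) C) : Proof (A.tensor B ∷ Γ) C
  | conjR {Γ : Ctx α} {A B : Formula α} (p : Proof Γ A) (q : Proof Γ B) : Proof Γ (A.conj B)
  | conjL₁ {Γ : Ctx α} {A C : Formula α} (B : Formula α) (p : Proof (A ∷ Γ) C) :
      Proof (A.conj B ∷ Γ) C
  | conjL₂ {Γ : Ctx α} {B C : Formula α} (A : Formula α) (p : Proof (B ∷ Γ) C) :
      Proof (A.conj B ∷ Γ) C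
  | limpR {Γ : Ctx α} {A B : Formula α} (p : Proof (A ∷ Γ) B) : Proof Γ (A.limp B)
  | limpL {Γ Δ : Ctx α} {A B C : Formula α} (p : Proof Γ A) (q : Proof (B ∷ Δ) C) :
      Proof (A.limp B ∷ (Γ ⨾ Δ)) C
  | der {Γ : Ctx α} {A B : Formula α} (p : Proof (A ∷ Γ) B) : Proof (A.bang ∷ Γ) B
  | prom {Γ : Ctx α} {A : Formula α} (p : Proof Γ.bang A) : Proof Γ.bang A.bang
  | ctr {Γ : Ctx α} {A B : Formula α} (p : Proof (A.bang ∷ A.bang ∷ Γ) B) : Proof (A.bang ∷ Γ) B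
  | wk {Γ : Ctx α} {B : Formula α} (A : Formula α) (p : Proof Γ B) : Proof (A.bang ∷ Γ) B

namespace Proof

open Exch

/-- Weakening by all formulas of `!Γ`. -/
def wkCtx {B : Formula α} : (Γ : Ctx α) → {Δ : Ctx α} → Proof Δ B → Proof (Γ.bang ⨾ Δ) B
  | .nil, Δ, p => exch (unit Δ).symm p
  | .single A, _, p => wk A p
  | .join Γ Γ', Δ, p => exch (assoc Γ.bang Γ'.bang Δ).symm (wkCtx Γ (wkCtx Γ' p))

/-- Contraction of all formulas of `!Γ`. -/
def ctrCtx {B : Formula α} :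
    (Γ : Ctx α) → {Δ : Ctx α} → Proof (Γ.bang ⨾ (Γ.bang ⨾ Δ)) B → Proof (Γ.bang ⨾ Δ) B
  | .nil, Δ, p => exch (unit (.nil ⨾ Δ)) p
  | .single _, _, p => ctr p
  | .join Γ Γ', Δ, p =>
      let X := Γ.bang
      let Y := Γ'.bang
      -- `(X, Y), (X, Y), Δ  →  X, X, Y, Y, Δ`
      let p₁ : Proof (X ⨾ (X ⨾ (Y ⨾ (Y ⨾ Δ)))) B :=
        exch ((assoc X Y ((X ⨾ Y) ⨾ Δ)).trans ((refl X).join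
          (((refl Y).join (assoc X Y Δ)).trans (lcomm Y X (Y ⨾ Δ))))) p
      -- `X, Y, Y, Δ  →  Y, Y, X, Δ`
      let p₂ : Proof (Y ⨾ (Y ⨾ (X ⨾ Δ))) B :=
        exch ((lcomm X Y (Y ⨾ Δ)).trans ((refl Y).join (lcomm X Y Δ))) (ctrCtx Γ p₁)
      exch ((lcomm Y X Δ).trans (assoc X Y Δ).symm) (ctrCtx Γ' p₂)

/-- A linear proof: no use of the rules for `!`. -/
def IsLinear : {Γ : Ctx α} → {A : Formula α} → Proof Γ A → Prop
  | _, _, ax _ => True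
  | _, _, exch _ p => p.IsLinear
  | _, _, cut p q => p.IsLinear ∧ q.IsLinear
  | _, _, tensorR p q => p.IsLinear ∧ q.IsLinear
  | _, _, tensorL p => p.IsLinear
  | _, _, conjR p q => p.IsLinear ∧ q.IsLinear
  | _, _, conjL₁ _ p => p.IsLinear
  | _, _, conjL₂ _ p => p.IsLinear
  | _, _, limpR p => p.IsLinear
  | _, _, limpL p q => p.IsLinear ∧ q.IsLinear
  | _, _, der _ => False
  | _, _, prom _ => False
  | _, _, ctr _ => False
  | _, _, wk _ _ => False

/-- Equivalence of proofs under cut-elimination: the congruence generated by the cut-elimination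
transformations, contexts being considered up to exchange. -/
inductive CutEq : {Γ : Ctx α} → {A : Formula α} → Proof Γ A → Proof Γ A → Prop
  -- equivalence relation
  | refl {Γ : Ctx α} {A : Formula α} (p : Proof Γ A) : CutEq p p
  | symm {Γ : Ctx α} {A : Formula α} {p q : Proof Γ A} : CutEq p q → CutEq q p
  | trans {Γ : Ctx α} {A : Formula α} {p q r : Proof Γ A} : CutEq p q → CutEq q r → CutEq p r
  -- compatibility with the deduction rules
  | congr_exch {Γ Δ : Ctx α} {A : Formula α} (e : Exch Γ Δ) {p p' : Proof Γ A} :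
      CutEq p p' → CutEq (exch e p) (exch e p')
  | congr_cut {Γ Δ : Ctx α} {A B : Formula α} {p p' : Proof Γ A} {q q' : Proof (A ∷ Δ) B} :
      CutEq p p' → CutEq q q' → CutEq (cut p q) (cut p' q')
  | congr_tensorR {Γ Δ : Ctx α} {A B : Formula α} {p p' : Proof Γ A} {q q' : Proof Δ B} :
      CutEq p p' → CutEq q q' → CutEq (tensorR p q) (tensorR p' q')
  | congr_tensorL {Γ : Ctx α} {A B C : Formula α} {p p' : Proof (A ∷ B ∷ Γ) C} :
      CutEq p p' → CutEq (tensorL p) (tensorL p')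
  | congr_conjR {Γ : Ctx α} {A B : Formula α} {p p' : Proof Γ A} {q q' : Proof Γ B} :
      CutEq p p' → CutEq q q' → CutEq (conjR p q) (conjR p' q')
  | congr_conjL₁ {Γ : Ctx α} {A B C : Formula α} {p p' : Proof (A ∷ Γ) C} :
      CutEq p p' → CutEq (conjL₁ B p) (conjL₁ B p')
  | congr_conjL₂ {Γ : Ctx α} {A B C : Formula α} {p p' : Proof (B ∷ Γ) C} :
      CutEq p p' → CutEq (conjL₂ A p) (conjL₂ A p')
  | congr_limpR {Γ : Ctx α} {A B : Formula α} {p p' : Proof (A ∷ Γ) B} :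
      CutEq p p' → CutEq (limpR p) (limpR p')
  | congr_limpL {Γ Δ : Ctx α} {A B C : Formula α} {p p' : Proof Γ A} {q q' : Proof (B ∷ Δ) C} :
      CutEq p p' → CutEq q q' → CutEq (limpL p q) (limpL p' q')
  | congr_der {Γ : Ctx α} {A B : Formula α} {p p' : Proof (A ∷ Γ) B} :
      CutEq p p' → CutEq (der p) (der p')
  | congr_prom {Γ : Ctx α} {A : Formula α} {p p' : Proof Γ.bang A} :
      CutEq p p' → CutEq (prom p) (prom p')
  | congr_ctr {Γ : Ctx α} {A B : Formula α} {p p' : Proof (A.bang ∷ A.bang ∷ Γ) B} :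
      CutEq p p' → CutEq (ctr p) (ctr p')
  | congr_wk {Γ : Ctx α} {A B : Formula α} {p p' : Proof Γ B} :
      CutEq p p' → CutEq (wk A p) (wk A p')
  -- exchanges act through their underlying permutation, and pass through all deduction rules
  | exch_perm {Γ Δ : Ctx α} {A : Formula α} (e f : Exch Γ Δ) (h : e.perm = f.perm)
      (p : Proof Γ A) : CutEq (exch e p) (exch f p)
  | exch_refl {Γ : Ctx α} {A : Formula α} (p : Proof Γ A) : CutEq (exch (.refl Γ) p) p
  | exch_exch {Γ Δ Θ : Ctx α} {A : Formula α} (e : Exch Γ Δ) (f : Exch Δ Θ) (p : Proof Γ A) :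
      CutEq (exch f (exch e p)) (exch (e.trans f) p)
  | exch_cut {Γ Γ' Δ Δ' : Ctx α} {A B : Formula α} (e : Exch Γ Γ') (f : Exch Δ Δ')
      (p : Proof Γ A) (q : Proof (A ∷ Δ) B) :
      CutEq (cut (exch e p) (exch ((Exch.refl _).join f) q)) (exch (e.join f) (cut p q))
  | exch_tensorR {Γ Γ' Δ Δ' : Ctx α} {A B : Formula α} (e : Exch Γ Γ') (f : Exch Δ Δ')
      (p : Proof Γ A) (q : Proof Δ B) :
      CutEq (tensorR (exch e p) (exch f q)) (exch (e.join f) (tensorR p q))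
  | exch_tensorL {Γ Γ' : Ctx α} {A B C : Formula α} (e : Exch Γ Γ') (p : Proof (A ∷ B ∷ Γ) C) :
      CutEq (tensorL (exch ((Exch.refl _).join ((Exch.refl _).join e)) p))
        (exch ((Exch.refl _).join e) (tensorL p))
  | exch_conjR {Γ Γ' : Ctx α} {A B : Formula α} (e : Exch Γ Γ') (p : Proof Γ A) (q : Proof Γ B) :
      CutEq (conjR (exch e p) (exch e q)) (exch e (conjR p q))
  | exch_conjL₁ {Γ Γ' : Ctx α} {A B C : Formula α} (e : Exch Γ Γ') (p : Proof (A ∷ Γ) C) :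
      CutEq (conjL₁ B (exch ((Exch.refl _).join e) p)) (exch ((Exch.refl _).join e) (conjL₁ B p))
  | exch_conjL₂ {Γ Γ' : Ctx α} {A B C : Formula α} (e : Exch Γ Γ') (p : Proof (B ∷ Γ) C) :
      CutEq (conjL₂ A (exch ((Exch.refl _).join e) p)) (exch ((Exch.refl _).join e) (conjL₂ A p))
  | exch_limpR {Γ Γ' : Ctx α} {A B : Formula α} (e : Exch Γ Γ') (p : Proof (A ∷ Γ) B) :
      CutEq (limpR (exch ((Exch.refl _).join e) p)) (exch e (limpR p))
  | exch_limpL {Γ Γ' Δ Δ' : Ctx α} {A B C : Formula α} (e : Exch Γ Γ') (f : Exch Δ Δ')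
      (p : Proof Γ A) (q : Proof (B ∷ Δ) C) :
      CutEq (limpL (exch e p) (exch ((Exch.refl _).join f) q))
        (exch ((Exch.refl _).join (e.join f)) (limpL p q))
  | exch_der {Γ Γ' : Ctx α} {A B : Formula α} (e : Exch Γ Γ') (p : Proof (A ∷ Γ) B) :
      CutEq (der (exch ((Exch.refl _).join e) p)) (exch ((Exch.refl _).join e) (der p))
  | exch_prom {Γ Γ' : Ctx α} {A : Formula α} (e : Exch Γ Γ') (p : Proof Γ.bang A) :
      CutEq (prom (exch e.bang p)) (exch e.bang (prom p))
  | exch_ctr {Γ Γ' : Ctx α} {A B : Formula α} (e : Exch Γ Γ')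
      (p : Proof (A.bang ∷ A.bang ∷ Γ) B) :
      CutEq (ctr (exch ((Exch.refl _).join ((Exch.refl _).join e)) p))
        (exch ((Exch.refl _).join e) (ctr p))
  | exch_wk {Γ Γ' : Ctx α} {A B : Formula α} (e : Exch Γ Γ') (p : Proof Γ B) :
      CutEq (wk A (exch e p)) (exch ((Exch.refl _).join e) (wk A p))
  -- cut against an axiom
  | cut_ax_left {Δ : Ctx α} {A B : Formula α} (q : Proof (A ∷ Δ) B) : CutEq (cut (ax A) q) q
  | cut_ax_right {Γ : Ctx α} {A : Formula α} (p : Proof Γ A) :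
      CutEq (cut p (exch (runit _).symm (ax A))) (exch (runit _).symm p)
  -- cut against cut
  | cut_cut {Γ Δ Θ : Ctx α} {A B C : Formula α} (p : Proof Γ A) (q : Proof (A ∷ Δ) B)
      (r : Proof (B ∷ Θ) C) :
      CutEq (cut (cut p q) r) (exch (assoc _ _ _).symm (cut p (exch (assoc _ _ _) (cut q r))))
  | cut_cut_comm {Γ Δ Θ : Ctx α} {A B C : Formula α} (p : Proof Γ A) (q : Proof Δ B)
      (r : Proof (A ∷ B ∷ Θ) C) :
      CutEq (cut p (exch (lcomm _ _ _) (cut q (exch (lcomm _ _ _) r))))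
        (exch (lcomm _ _ _) (cut q (exch (lcomm _ _ _) (cut p r))))
  -- the cut formula is principal in both premises
  | cut_tensor {Γ Δ Θ : Ctx α} {A B C : Formula α} (p : Proof Γ A) (q : Proof Δ B)
      (r : Proof (A ∷ B ∷ Θ) C) :
      CutEq (cut (tensorR p q) (tensorL r))
        (exch (assoc _ _ _).symm (cut p (exch (lcomm _ _ _) (cut q (exch (lcomm _ _ _) r)))))
  | cut_conj₁ {Γ Δ : Ctx α} {A B C : Formula α} (p : Proof Γ A) (q : Proof Γ B)
      (r : Proof (A ∷ Δ) C) : CutEq (cut (conjR p q) (conjL₁ B r)) (cut p r)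
  | cut_conj₂ {Γ Δ : Ctx α} {A B C : Formula α} (p : Proof Γ A) (q : Proof Γ B)
      (r : Proof (B ∷ Δ) C) : CutEq (cut (conjR p q) (conjL₂ A r)) (cut q r)
  | cut_limp {Γ Δ Θ : Ctx α} {A B C : Formula α} (p : Proof (A ∷ Γ) B) (q : Proof Δ A)
      (r : Proof (B ∷ Θ) C) :
      CutEq (cut (limpR p) (limpL q r))
        (exch ((assoc _ _ _).trans (lcomm _ _ _)) (cut (cut q p) r))
  | cut_prom_der {Γ Δ : Ctx α} {A B : Formula α} (p : Proof Γ.bang A) (q : Proof (A ∷ Δ) B) :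
      CutEq (cut (prom p) (der q)) (cut p q)
  | cut_prom_wk {Γ Δ : Ctx α} {A B : Formula α} (p : Proof Γ.bang A) (q : Proof Δ B) :
      CutEq (cut (prom p) (wk A q)) (wkCtx Γ q)
  | cut_prom_ctr {Γ Δ : Ctx α} {A B : Formula α} (p : Proof Γ.bang A)
      (q : Proof (A.bang ∷ A.bang ∷ Δ) B) :
      CutEq (cut (prom p) (ctr q))
        (ctrCtx Γ (cut (prom p) (exch (lcomm _ _ _) (cut (prom p) q))))
  -- the left premise ends with a left rule
  | cut_tensorL_left {Γ Δ : Ctx α} {A B C D : Formula α} (p : Proof (A ∷ B ∷ Γ) C)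
      (q : Proof (C ∷ Δ) D) :
      CutEq (cut (tensorL p) q)
        (exch (assoc _ _ _).symm (tensorL (exch (assoc₂ _ _ _ _) (cut p q))))
  | cut_conjL₁_left {Γ Δ : Ctx α} {A B C D : Formula α} (p : Proof (A ∷ Γ) C)
      (q : Proof (C ∷ Δ) D) :
      CutEq (cut (conjL₁ B p) q)
        (exch (assoc _ _ _).symm (conjL₁ B (exch (assoc _ _ _) (cut p q))))
  | cut_conjL₂_left {Γ Δ : Ctx α} {A B C D : Formula α} (p : Proof (B ∷ Γ) C)
      (q : Proof (C ∷ Δ) D) :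
      CutEq (cut (conjL₂ A p) q)
        (exch (assoc _ _ _).symm (conjL₂ A (exch (assoc _ _ _) (cut p q))))
  | cut_limpL_left {Γ Γ' Δ : Ctx α} {A B C D : Formula α} (p : Proof Γ A) (p' : Proof (B ∷ Γ') C)
      (q : Proof (C ∷ Δ) D) :
      CutEq (cut (limpL p p') q)
        (exch (assoc₂ _ _ _ _).symm (limpL p (exch (assoc _ _ _) (cut p' q))))
  | cut_der_left {Γ Δ : Ctx α} {A B C : Formula α} (p : Proof (A ∷ Γ) B) (q : Proof (B ∷ Δ) C) :
      CutEq (cut (der p) q) (exch (assoc _ _ _).symm (der (exch (assoc _ _ _) (cut p q))))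
  | cut_ctr_left {Γ Δ : Ctx α} {A B C : Formula α} (p : Proof (A.bang ∷ A.bang ∷ Γ) B)
      (q : Proof (B ∷ Δ) C) :
      CutEq (cut (ctr p) q) (exch (assoc _ _ _).symm (ctr (exch (assoc₂ _ _ _ _) (cut p q))))
  | cut_wk_left {Γ Δ : Ctx α} {A B C : Formula α} (p : Proof Γ B) (q : Proof (B ∷ Δ) C) :
      CutEq (cut (wk A p) q) (exch (assoc _ _ _).symm (wk A (cut p q)))
  -- the right premise ends with a rule in which the cut formula is not principal
  | cut_tensorR_right₁ {Γ Δ Δ' : Ctx α} {A B C : Formula α} (p : Proof Γ C)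
      (q : Proof (C ∷ Δ) A) (q' : Proof Δ' B) :
      CutEq (cut p (exch (assoc _ _ _) (tensorR q q'))) (exch (assoc _ _ _) (tensorR (cut p q) q'))
  | cut_tensorR_right₂ {Γ Δ Δ' : Ctx α} {A B C : Formula α} (p : Proof Γ C)
      (q : Proof Δ A) (q' : Proof (C ∷ Δ') B) :
      CutEq (cut p (exch (lcomm _ _ _) (tensorR q q'))) (exch (lcomm _ _ _) (tensorR q (cut p q')))
  | cut_tensorL_right {Γ Δ : Ctx α} {A B C D : Formula α} (p : Proof Γ C)
      (q : Proof (A ∷ B ∷ C ∷ Δ) D) :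
      CutEq (cut p (exch (lcomm _ _ _) (tensorL q)))
        (exch (lcomm _ _ _)
          (tensorL (exch (lcomm₂ _ _ _ _).symm (cut p (exch (lcomm₂ _ _ _ _) q)))))
  | cut_conjR_right {Γ Δ : Ctx α} {A B C : Formula α} (p : Proof Γ C)
      (q : Proof (C ∷ Δ) A) (q' : Proof (C ∷ Δ) B) :
      CutEq (cut p (conjR q q')) (conjR (cut p q) (cut p q'))
  | cut_conjL₁_right {Γ Δ : Ctx α} {A B C D : Formula α} (p : Proof Γ C)
      (q : Proof (A ∷ C ∷ Δ) D) :
      CutEq (cut p (exch (lcomm _ _ _) (conjL₁ B q)))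
        (exch (lcomm _ _ _) (conjL₁ B (exch (lcomm _ _ _) (cut p (exch (lcomm _ _ _) q)))))
  | cut_conjL₂_right {Γ Δ : Ctx α} {A B C D : Formula α} (p : Proof Γ C)
      (q : Proof (B ∷ C ∷ Δ) D) :
      CutEq (cut p (exch (lcomm _ _ _) (conjL₂ A q)))
        (exch (lcomm _ _ _) (conjL₂ A (exch (lcomm _ _ _) (cut p (exch (lcomm _ _ _) q)))))
  | cut_limpR_right {Γ Δ : Ctx α} {A B C : Formula α} (p : Proof Γ C)
      (q : Proof (A ∷ C ∷ Δ) B) :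
      CutEq (cut p (limpR q)) (limpR (exch (lcomm _ _ _) (cut p (exch (lcomm _ _ _) q))))
  | cut_limpL_right₁ {Γ Δ Δ' : Ctx α} {A B C D : Formula α} (p : Proof Γ C)
      (q : Proof (C ∷ Δ) A) (q' : Proof (B ∷ Δ') D) :
      CutEq (cut p (exch (((Exch.refl _).join (assoc _ _ _)).trans (lcomm _ _ _)) (limpL q q')))
        (exch (((Exch.refl _).join (assoc _ _ _)).trans (lcomm _ _ _)) (limpL (cut p q) q'))
  | cut_limpL_right₂ {Γ Δ Δ' : Ctx α} {A B C D : Formula α} (p : Proof Γ C)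
      (q : Proof Δ A) (q' : Proof (B ∷ C ∷ Δ') D) :
      CutEq (cut p (exch (lcomm₂ _ _ _ _) (limpL q q')))
        (exch (lcomm₂ _ _ _ _) (limpL q (exch (lcomm _ _ _) (cut p (exch (lcomm _ _ _) q')))))
  | cut_der_right {Γ Δ : Ctx α} {A B C : Formula α} (p : Proof Γ C) (q : Proof (A ∷ C ∷ Δ) B) :
      CutEq (cut p (exch (lcomm _ _ _) (der q)))
        (exch (lcomm _ _ _) (der (exch (lcomm _ _ _) (cut p (exch (lcomm _ _ _) q)))))
  | cut_ctr_right {Γ Δ : Ctx α} {A B C : Formula α} (p : Proof Γ C)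
      (q : Proof (A.bang ∷ A.bang ∷ C ∷ Δ) B) :
      CutEq (cut p (exch (lcomm _ _ _) (ctr q)))
        (exch (lcomm _ _ _)
          (ctr (exch (lcomm₂ _ _ _ _).symm (cut p (exch (lcomm₂ _ _ _ _) q)))))
  | cut_wk_right {Γ Δ : Ctx α} {A B C : Formula α} (p : Proof Γ C) (q : Proof (C ∷ Δ) B) :
      CutEq (cut p (exch (lcomm _ _ _) (wk A q))) (exch (lcomm _ _ _) (wk A (cut p q)))
  | cut_prom_prom {Γ Δ : Ctx α} {A B : Formula α} (p : Proof Γ.bang A)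
      (q : Proof (A ∷ Δ).bang B) :
      CutEq (cut (prom p) (prom q)) (prom (Γ := Γ ⨾ Δ) (cut (prom p) q))
  -- expansion of axioms
  | eta_tensor (A B : Formula α) :
      CutEq (ax (A.tensor B))
        (exch (runit _) (tensorL (exch ((Exch.refl _).join (runit _).symm)
          (tensorR (ax A) (ax B)))))
  | eta_conj (A B : Formula α) :
      CutEq (ax (A.conj B))
        (conjR (exch (runit _) (conjL₁ B (exch (runit _).symm (ax A))))
          (exch (runit _) (conjL₂ A (exch (runit _).symm (ax B)))))
  | eta_limp (A B : Formula α) :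
      CutEq (ax (A.limp B))
        (limpR (exch (((Exch.refl _).join (runit _)).trans (comm _ _))
          (limpL (ax A) (exch (runit _).symm (ax B)))))
  | eta_bang (A : Formula α) :
      CutEq (ax A.bang)
        (prom (Γ := .single A) (exch (runit _) (der (exch (runit _).symm (ax A)))))

/-! ### Plain proofs with one input -/

/-- `π(X₁, …, Xₙ)`: the cut of `π : n A ⊢ B` against the proofs `X₁, …, Xₙ` of `⊢ A`. -/
def evalLinear {A B : Formula α} :
    (n : ℕ) → Proof (Ctx.rep A n) B → (Fin n → Proof .nil A) → Proof .nil B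
  | 0, π, _ => π
  | n + 1, π, X => evalLinear n (exch (unit _) (cut (X 0) π)) (fun i => X i.succ)

/-- `ψ(ρ)`: the cut of `ψ : !A ⊢ B` against the promotion of the proof `ρ` of `⊢ A`. -/
def evalBang {A B : Formula α} (ψ : Proof (.single A.bang) B) (ρ : Proof .nil A) : Proof .nil B :=
  exch (unit _) (cut (prom (Γ := .nil) ρ) (exch (runit _).symm ψ))

/-- `p` is obtained from `π` by derelictions of hypotheses `A` (and exchanges). -/
inductive Derelicted {Γ₀ : Ctx α} {A B : Formula α} (π : Proof Γ₀ B) :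
    {Γ : Ctx α} → Proof Γ B → Prop
  | base : Derelicted π π
  | exch {Γ Δ : Ctx α} (e : Exch Γ Δ) {p : Proof Γ B} :
      Derelicted (A := A) π p → Derelicted π (exch e p)
  | der {Γ : Ctx α} {p : Proof (A ∷ Γ) B} : Derelicted (A := A) π p → Derelicted π (der p)

/-- `p` is obtained from `π : n A ⊢ B` by derelictions of hypotheses `A`, followed by contractions
of hypotheses `!A` or, if `n = 0`, by weakening (and exchanges). -/
inductive Contracted {A B : Formula α} {n : ℕ} (π : Proof (Ctx.rep A n) B) :
    {Γ : Ctx α} → Proof Γ B → Prop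
  | base {Γ : Ctx α} {p : Proof Γ B} : Derelicted (A := A) π p → Contracted π p
  | exch {Γ Δ : Ctx α} (e : Exch Γ Δ) {p : Proof Γ B} : Contracted π p → Contracted π (exch e p)
  | ctr {Γ : Ctx α} {p : Proof (A.bang ∷ A.bang ∷ Γ) B} : Contracted π p → Contracted π (ctr p)
  | wk {Γ : Ctx α} {p : Proof Γ B} (hn : n = 0) : Contracted π p → Contracted π (wk A p)

/-- `ψ : !A ⊢ B` is a plain proof of degree `n` with linear part `π : n A ⊢ B`: it is equivalent
under cut-elimination to a proof obtained from the linear proof `π` by derelictions followed by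
contractions or weakening. -/
def IsPlainWith {A B : Formula α} {n : ℕ} (ψ : Proof (.single A.bang) B)
    (π : Proof (Ctx.rep A n) B) : Prop :=
  π.IsLinear ∧ ∃ φ : Proof (.single A.bang) B, Contracted π φ ∧ CutEq ψ φ

/-- The number of positions `i` such that `π` evaluates to `τ` (up to equivalence under
cut-elimination) when its `i`-th input is `ρ₁` and all its other inputs are `ρ₀`: the number of
weight one error syndromes that produce `τ`. -/
noncomputable def weightOneCount {A B : Formula α} {n : ℕ} (π : Proof (Ctx.rep A n) B)
    (ρ₀ ρ₁ : Proof .nil A) (τ : Proof .nil B) : ℕ :=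
  {i : Fin n | CutEq (evalLinear n π (Function.update (fun _ => ρ₀) i ρ₁)) τ}.ncard

end Proof

/-! ### The cofree coalgebra -/

section Cofree

variable (k : Type u) [Field k] (V : Type u) [AddCommGroup V] [Module k V]

/-- `!V = ⨁_{P ∈ V} Sym_P(V)`, where each `Sym_P(V)` is a copy of the symmetric algebra of `V` with
its canonical coalgebra structure. -/
def Bang : Type u := V →₀ SymmetricAlgebra k V

noncomputable instance : AddCommGroup (Bang k V) :=
  inferInstanceAs (AddCommGroup (V →₀ SymmetricAlgebra k V))

noncomputable instance : Module k (Bang k V) :=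
  inferInstanceAs (Module k (V →₀ SymmetricAlgebra k V))

noncomputable instance : Coalgebra k (Bang k V) :=
  inferInstanceAs (Coalgebra k (V →₀ SymmetricAlgebra k V))

variable {V}

/-- The inclusion of `Sym_P(V)` in `!V`. -/
noncomputable def symIncl (P : V) : SymmetricAlgebra k V →ₗ[k] Bang k V :=
  Finsupp.lsingle (R := k) P

/-- The vector `|v₁, …, vₛ⟩_P` of `Sym_P(V) ⊆ !V`. -/
noncomputable def ket (P : V) (v : List V) : Bang k V :=
  symIncl k P (v.map (SymmetricAlgebra.ι k V)).prod

variable (V)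

/-- The projection of the symmetric algebra to its degree one part, obtained from the morphism of
algebras `Sym(V) → k ⊕ V` (with `V * V = 0`) that extends the inclusion of `V`. -/
noncomputable def symDegOne : SymmetricAlgebra k V →ₗ[k] V :=
  letI : Module kᵐᵒᵖ V := Module.compHom V ((RingHom.id k).fromOpposite mul_comm)
  haveI : IsCentralScalar k V := ⟨fun _ _ => rfl⟩
  TrivSqZeroExt.sndHom k V ∘ₗ
    (SymmetricAlgebra.lift (TrivSqZeroExt.inrHom k V)).toLinearMap

/-- The universal map `d : !V → V`: on `Sym_P(V)` it is `x ↦ ε(x) P + x₁`, where `x₁` is the degree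
one part of `x`. -/
noncomputable def bangCounit : Bang k V →ₗ[k] V :=
  Finsupp.lsum (R := k) k fun P : V =>
    (LinearMap.toSpanSingleton k V P) ∘ₗ (Coalgebra.counit (R := k)) + symDegOne k V

variable {V}

theorem bangCounit_ket_nil (P : V) : bangCounit k V (ket k P []) = P := by
  let _ : Module kᵐᵒᵖ V := Module.compHom V ((RingHom.id k).fromOpposite mul_comm)
  have : IsCentralScalar k V := ⟨fun _ _ => rfl⟩
  have h : symDegOne k V 1 = 0 := by
    change (SymmetricAlgebra.lift (TrivSqZeroExt.inrHom k V) (1 : SymmetricAlgebra k V)).snd = 0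
    rw [map_one]
    rfl
  change Finsupp.lsum (R := k) k _ (Finsupp.single P (1 : SymmetricAlgebra k V)) = P
  simp [h]

theorem bangCounit_ket_singleton (P v : V) : bangCounit k V (ket k P [v]) = v := by
  let _ : Module kᵐᵒᵖ V := Module.compHom V ((RingHom.id k).fromOpposite mul_comm)
  have : IsCentralScalar k V := ⟨fun _ _ => rfl⟩
  have h : symDegOne k V (SymmetricAlgebra.ι k V v) = v := by
    change (SymmetricAlgebra.lift (TrivSqZeroExt.inrHom k V) (SymmetricAlgebra.ι k V v)).snd = v
    rw [SymmetricAlgebra.lift_ι_apply]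
    rfl
  change Finsupp.lsum (R := k) k _ (Finsupp.single P ([v].map (SymmetricAlgebra.ι k V)).prod) = v
  simp [h]

theorem bangCounit_ket_cons_cons (P v w : V) (l : List V) :
    bangCounit k V (ket k P (v :: w :: l)) = 0 := by
  let _ : Module kᵐᵒᵖ V := Module.compHom V ((RingHom.id k).fromOpposite mul_comm)
  have : IsCentralScalar k V := ⟨fun _ _ => rfl⟩
  have h : symDegOne k V (((v :: w :: l).map (SymmetricAlgebra.ι k V)).prod) = 0 := by
    change (SymmetricAlgebra.lift (TrivSqZeroExt.inrHom k V)
      (((v :: w :: l).map (SymmetricAlgebra.ι k V)).prod)).snd = 0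
    rw [List.map_cons, List.map_cons, List.prod_cons, List.prod_cons, ← mul_assoc, map_mul,
      map_mul, SymmetricAlgebra.lift_ι_apply, SymmetricAlgebra.lift_ι_apply]
    simp
  have h' : Coalgebra.counit (R := k) (((v :: w :: l).map (SymmetricAlgebra.ι k V)).prod) = 0 := by
    change SymmetricAlgebra.algebraMapInv _ = (0 : k)
    rw [List.map_cons, List.prod_cons, map_mul, SymmetricAlgebra.algebraMapInv_ι, zero_mul]
  change Finsupp.lsum (R := k) k _
    (Finsupp.single P (((v :: w :: l).map (SymmetricAlgebra.ι k V)).prod)) = 0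
  rw [Finsupp.lsum_single, LinearMap.add_apply, h, LinearMap.comp_apply, h', map_zero, add_zero]

open Classical in
/-- The unique morphism of coalgebras `Φ : C → !V` with `d ∘ Φ = φ`, for a cocommutative coalgebra `C`
and a linear map `φ : C → V`. It exists by the universal property of `!V`, which holds over an
algebraically closed field `k` of characteristic zero. -/
noncomputable def cofreeLift {C : Type u} [AddCommGroup C] [Module k C] [Coalgebra k C]
    (φ : C →ₗ[k] V) : C →ₗ[k] Bang k V :=
  if h : ∃! Φ : C →ₗc[k] Bang k V, bangCounit k V ∘ₗ Φ.toLinearMap = φ then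
    h.choose.toLinearMap
  else 0

end Cofree

/-! ### Denotations -/

section Denotation

variable {k : Type u} [Field k] (V : α → ModuleCat.{u} k)

/-- The vector space denoting a formula, given those denoting the atomic formulas. -/
noncomputable def Formula.den : Formula α → ModuleCat.{u} k
  | .atom a => V a
  | .tensor A B => ModuleCat.of k (A.den ⊗[k] B.den)
  | .conj A B => ModuleCat.of k (A.den × B.den)
  | .limp A B => ModuleCat.of k (A.den →ₗ[k] B.den)
  | .bang A => ModuleCat.of k (Bang k A.den)

/-- The vector space denoting a context: the tensor product of the denotations of its formulas. -/
noncomputable def Ctx.den : Ctx α → ModuleCat.{u} k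
  | .nil => ModuleCat.of k k
  | .single A => A.den V
  | .join Γ Δ => ModuleCat.of k (Γ.den ⊗[k] Δ.den)

/-- The coalgebra structure of `⟦!Γ⟧ = !⟦A₁⟧ ⊗ ⋯ ⊗ !⟦Aᵣ⟧`. -/
noncomputable instance Ctx.bangCoalgebra : (Γ : Ctx α) → Coalgebra k (Γ.bang.den V)
  | .nil => inferInstanceAs (Coalgebra k k)
  | .single A => inferInstanceAs (Coalgebra k (Bang k (A.den V)))
  | .join Γ Δ =>
      letI := Ctx.bangCoalgebra Γ
      letI := Ctx.bangCoalgebra Δ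
      inferInstanceAs (Coalgebra k (Γ.bang.den V ⊗[k] Δ.bang.den V))

/-- The denotation of an exchange. -/
noncomputable def Exch.den : {Γ Δ : Ctx α} → Exch Γ Δ → (Γ.den V ≃ₗ[k] Δ.den V)
  | _, _, .refl _ => LinearEquiv.refl k _
  | _, _, .symm e => (Exch.den e).symm
  | _, _, .trans e f => (Exch.den e).trans (Exch.den f)
  | _, _, .join e f => TensorProduct.congr (Exch.den e) (Exch.den f)
  | _, _, .comm _ _ => TensorProduct.comm k _ _
  | _, _, .assoc _ _ _ => TensorProduct.assoc k _ _ _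
  | _, _, .unit _ => TensorProduct.lid k _

/-- The denotation `⟦p⟧ : ⟦Γ⟧ → ⟦A⟧` of a proof `p` of `Γ ⊢ A`. -/
noncomputable def Proof.den :
    {Γ : Ctx α} → {A : Formula α} → Proof Γ A → (Γ.den V →ₗ[k] A.den V)
  | _, _, .ax _ => LinearMap.id
  | _, _, .exch e p => p.den ∘ₗ (e.den V).symm.toLinearMap
  | _, _, .cut p q => q.den ∘ₗ TensorProduct.map p.den LinearMap.id
  | _, _, .tensorR p q => TensorProduct.map p.den q.den
  | _, _, .tensorL p => p.den ∘ₗ (TensorProduct.assoc k _ _ _).toLinearMap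
  | _, _, .conjR p q => LinearMap.prod p.den q.den
  | _, _, .conjL₁ (A := A) B p =>
      p.den ∘ₗ TensorProduct.map (LinearMap.fst k (A.den V) (B.den V)) LinearMap.id
  | _, _, .conjL₂ (B := B) A p =>
      p.den ∘ₗ TensorProduct.map (LinearMap.snd k (A.den V) (B.den V)) LinearMap.id
  | _, _, .limpR p => (TensorProduct.curry p.den).flip
  | _, _, .limpL p q =>
      -- `f ⊗ (γ ⊗ δ) ↦ ⟦q⟧(f(⟦p⟧ γ) ⊗ δ)`
      q.den ∘ₗ TensorProduct.map
          (TensorProduct.lift LinearMap.id ∘ₗ TensorProduct.map LinearMap.id p.den) LinearMap.id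
        ∘ₗ (TensorProduct.assoc k _ _ _).symm.toLinearMap
  | _, _, .der (A := A) p =>
      p.den ∘ₗ TensorProduct.map (bangCounit k (A.den V)) LinearMap.id
  | _, _, .prom p => cofreeLift k p.den
  | _, _, .ctr (A := A) p =>
      p.den ∘ₗ (TensorProduct.assoc k _ _ _).toLinearMap
        ∘ₗ TensorProduct.map (Coalgebra.comul (R := k) (A := Bang k (A.den V))) LinearMap.id
  | _, _, .wk A p =>
      p.den ∘ₗ (TensorProduct.lid k _).toLinearMap
        ∘ₗ TensorProduct.map (Coalgebra.counit (R := k) (A := Bang k (A.den V))) LinearMap.id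

/-- The vector `⟦ρ⟧ ∈ ⟦A⟧` denoting a proof `ρ` of `⊢ A`: the image of `1` under
`⟦ρ⟧ : k → ⟦A⟧`. -/
noncomputable def Proof.vec {A : Formula α} (ρ : Proof .nil A) : A.den V :=
  ρ.den V (1 : k)

end Denotation

end LinLog

/-!
The denotation of a plain proof `ψ` is computed at the tangent vector `|Q - P⟩_P`, where `P = ⟦ρ₀⟧` and
`Q = ⟦ρ₁⟧`. To first order `|∅⟩_P + ε |v⟩_P` is group-like over `P + ε v`, so dereliction,
contraction and weakening act on it as they would act on `n` copies of `P + ε v`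
(`Proof.Contracted.den_eq`). Hence `⟦ψ⟧ |v⟩_P` is the directional derivative of the multilinear
map `⟦π⟧` at `(P, …, P)`, and for `v = Q - P` this is the sum over `i` of
`⟦π(0, …, 1, …, 0)⟧ - ⟦π(0, …, 0)⟧` (`Proof.IsPlainWith.den_ket`). Grouping the terms by the element
of the finite set of outcomes to which they are equivalent gives the formula.

Since `ψ` is only equivalent to a proof built from `π`, and outcomes are compared up to equivalence,
denotations have to be invariant under cut-elimination (`Proof.CutEq.den_eq`). Almost all
transformations are identities between multilinear maps, checked on pure tensors. Exchanges act
through their permutation because they permute the factors of pure tensors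
(`Exch.den_eq_of_perm_eq`). The transformations involving promotion need the universal property of
`!V` for the coalgebras `⟦!Γ⟧` (`CoderivGenerated.existsUnique_coalgHom`).

The universal property is proved by duality with polynomial functions on `V`, that is, elements of
`Sym(V*)`. A linear map `φ : C → V` from a cocommutative coalgebra induces a morphism of algebras
`polyPull φ` from `Sym(V*)` to the convolution algebra `C*`. For the universal map `d` this is a
pairing of `!V` with `Sym(V*)`, the element `|v₁, …, vₛ⟩_P` acting as the derivative
`∂_{v₁} ⋯ ∂_{vₛ}` at `P`. In characteristic zero the pairing separates the elements of `!V`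
(`bang_eq_zero_of_polyPull`), which gives uniqueness. For existence, every functional
`f ↦ polyPull φ f c` has to be represented by an element of `!V`. This holds at group-like `c`,
where the functional is the evaluation at a point, and is inherited by the image of `c` under a
coderivation, by the chain rule (`polyPull_coderivation`). The coalgebras `⟦!Γ⟧` are spanned by what
coderivations generate from group-like elements, a property preserved by tensor products.
-/

namespace LinLog

open Coalgebra WithConv

/-! ### Coderivations and the convolution algebra -/

section Convolution

variable {k : Type*} [Field k] {C : Type*} [AddCommGroup C] [Module k C] [Coalgebra k C]

/-- A coderivation of a coalgebra: an endomorphism `m` with `Δ m = (m ⊗ 1 + 1 ⊗ m) Δ`. -/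
def IsCoderivation (m : C →ₗ[k] C) : Prop :=
  comul (R := k) ∘ₗ m = (m.rTensor C + m.lTensor C) ∘ₗ comul

theorem IsCoderivation.comul_apply {m : C →ₗ[k] C} (hm : IsCoderivation m) (x : C) :
    comul (R := k) (m x) = m.rTensor C (comul x) + m.lTensor C (comul x) :=
  LinearMap.congr_fun hm x

theorem IsCoderivation.counit_apply {m : C →ₗ[k] C} (hm : IsCoderivation m) (x : C) :
    counit (R := k) (m x) = 0 := by
  have h1 : LinearMap.mul' k k (TensorProduct.map counit counit (comul (R := k) (m x))) =
      counit (R := k) (m x) := by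
    have := LinearMap.congr_fun (congrArg WithConv.ofConv
      (one_mul (1 : WithConv (C →ₗ[k] k)))) (m x)
    exact this
  have h2 : ∀ t : C ⊗[k] C, LinearMap.mul' k k (TensorProduct.map counit counit
      (m.rTensor C t + m.lTensor C t)) =
      counit (R := k) (m (TensorProduct.rid k C (counit.lTensor C t))) +
      counit (R := k) (m (TensorProduct.lid k C (counit.rTensor C t))) := by
    intro t
    induction t with
    | zero => simp
    | tmul a b => simp [mul_comm]
    | add a b ha hb =>
      simp only [map_add] at ha hb ⊢
      linear_combination ha + hb
  have h3 := h2 (comul x)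
  rw [← hm.comul_apply, h1] at h3
  simpa using h3

/-- The convolution product is a derivation with respect to precomposition with a coderivation. -/
theorem IsCoderivation.convMul_apply {m : C →ₗ[k] C} (hm : IsCoderivation m)
    (a b : WithConv (C →ₗ[k] k)) (x : C) :
    (a * b) (m x) = (toConv (a.ofConv ∘ₗ m) * b) x + (a * toConv (b.ofConv ∘ₗ m)) x := by
  simp only [LinearMap.convMul_apply, hm.comul_apply, map_add]
  congr 2
  · exact LinearMap.congr_fun (LinearMap.map_comp_rTensor (R := k) C a.ofConv b.ofConv m) _
  · exact LinearMap.congr_fun (LinearMap.map_comp_lTensor (R := k) C a.ofConv b.ofConv m) _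

/-- The functional `x ↦ ∑ u(x₁)(x₂)` given by a linear family `u` of functionals. -/
noncomputable def convFamily (u : C →ₗ[k] C →ₗ[k] k) : WithConv (C →ₗ[k] k) :=
  toConv (TensorProduct.lift u ∘ₗ comul)

/-- Multiplying each functional of a family by `e` multiplies `convFamily` by `e`: this is
coassociativity. -/
theorem convFamily_mul (u w : C →ₗ[k] C →ₗ[k] k) (e : WithConv (C →ₗ[k] k))
    (h : ∀ c, w c = (toConv (u c) * e).ofConv) : convFamily w = convFamily u * e := by
  ext x
  let G : C →ₗ[k] (C ⊗[k] C) →ₗ[k] k := LinearMap.mk₂ k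
    (fun c s => LinearMap.mul' k k (TensorProduct.map (u c) e.ofConv s))
    (by intros; simp [TensorProduct.map_add_left])
    (by intros; simp [TensorProduct.map_smul_left]) (by intros; simp) (by intros; simp)
  have hG : LinearMap.mul' k k ∘ₗ TensorProduct.map (TensorProduct.lift u) e.ofConv =
      TensorProduct.lift G ∘ₗ (TensorProduct.assoc k C C C).toLinearMap := by
    ext a b c
    simp [G]
  replace hG := fun t => LinearMap.congr_fun hG t
  simp only [LinearMap.comp_apply, LinearEquiv.coe_coe] at hG
  have h1 : (convFamily u * e) x = LinearMap.mul' k k (TensorProduct.map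
      (TensorProduct.lift u) e.ofConv (comul.rTensor C (comul x))) := by
    rw [LinearMap.convMul_apply]
    generalize comul (R := k) x = t
    induction t with
    | zero => simp
    | tmul a b => simp [convFamily]
    | add a b ha hb => simp only [map_add, ha, hb]
  change (convFamily w) x = (convFamily u * e) x
  rw [h1, hG, coassoc_apply]
  change TensorProduct.lift w (comul x) = _
  generalize comul (R := k) x = t
  induction t with
  | zero => simp
  | tmul a b => simp [h, G]
  | add a b ha hb => simp only [map_add, ha, hb]

theorem convFamily_add (u w : C →ₗ[k] C →ₗ[k] k) :
    convFamily (u + w) = convFamily u + convFamily w := by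
  have h : TensorProduct.lift (u + w) = TensorProduct.lift u + TensorProduct.lift w := by
    ext; simp
  ext x
  simp [convFamily, h]

theorem convFamily_zero : convFamily (0 : C →ₗ[k] C →ₗ[k] k) = 0 := by
  have h : TensorProduct.lift (0 : C →ₗ[k] C →ₗ[k] k) = 0 := by
    ext; simp
  ext x
  simp [convFamily, h]

end Convolution

/-! ### Polynomial functions on a vector space -/

section Polynomial

variable {k : Type*} [Field k] {V : Type*} [AddCommGroup V] [Module k V]

local notation "𝒫" => SymmetricAlgebra k (Module.Dual k V)

variable (k V) in
/-- A polynomial function together with its total derivative, as a morphism of algebras from `Sym(V*)`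
to the trivial square zero extension of `Sym(V*)` by `Hom(V, Sym(V*))`. -/
noncomputable def polyDerivAux : 𝒫 →ₐ[k] TrivSqZeroExt 𝒫 (V →ₗ[k] 𝒫) :=
  SymmetricAlgebra.lift
    (TrivSqZeroExt.inlAlgHom k 𝒫 (V →ₗ[k] 𝒫) ∘ₗ SymmetricAlgebra.ι k (Module.Dual k V) +
      (TrivSqZeroExt.inrHom 𝒫 (V →ₗ[k] 𝒫)).restrictScalars k ∘ₗ
        LinearMap.compRight k (Algebra.linearMap k 𝒫))

variable (k V) in
/-- The total derivative `f ↦ (v ↦ ∂ᵥ f)` of polynomial functions on `V`. -/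
noncomputable def polyDeriv : 𝒫 →ₗ[k] V →ₗ[k] 𝒫 :=
  (TrivSqZeroExt.sndHom 𝒫 (V →ₗ[k] 𝒫)).restrictScalars k ∘ₗ (polyDerivAux k V).toLinearMap

theorem fst_polyDerivAux (f : 𝒫) : (polyDerivAux k V f).fst = f := by
  have : (TrivSqZeroExt.fstHom k 𝒫 (V →ₗ[k] 𝒫)).comp (polyDerivAux k V) = AlgHom.id k 𝒫 := by
    ext ξ
    simp [polyDerivAux]
  exact DFunLike.congr_fun this f

@[simp]
theorem polyDeriv_algebraMap (r : k) : polyDeriv k V (algebraMap k 𝒫 r) = 0 := by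
  change (polyDerivAux k V (algebraMap k 𝒫 r)).snd = 0
  rw [AlgHom.commutes]
  rfl

@[simp]
theorem polyDeriv_ι (ξ : Module.Dual k V) (v : V) :
    polyDeriv k V (SymmetricAlgebra.ι k _ ξ) v = algebraMap k 𝒫 (ξ v) := by
  change (polyDerivAux k V (SymmetricAlgebra.ι k _ ξ)).snd v = _
  simp [polyDerivAux]

theorem polyDeriv_mul (f g : 𝒫) (v : V) :
    polyDeriv k V (f * g) v = f * polyDeriv k V g v + g * polyDeriv k V f v := by
  change (polyDerivAux k V (f * g)).snd v = _
  rw [map_mul, TrivSqZeroExt.snd_mul, fst_polyDerivAux, fst_polyDerivAux, op_smul_eq_smul]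
  rfl

variable {C : Type*} [AddCommGroup C] [Module k C] [Coalgebra k C] [IsCocomm k C]

/-- Pulling back polynomial functions on `V` along a linear map `φ : C → V`: the morphism of algebras
from `Sym(V*)` to the convolution algebra `C*` that sends `ξ` to `ξ ∘ φ`. -/
noncomputable def polyPull (φ : C →ₗ[k] V) : 𝒫 →ₐ[k] WithConv (C →ₗ[k] k) :=
  SymmetricAlgebra.lift
    ((WithConv.linearEquiv k (C →ₗ[k] k)).symm.toLinearMap ∘ₗ LinearMap.lcomp k k φ)

@[simp]
theorem polyPull_ι (φ : C →ₗ[k] V) (ξ : Module.Dual k V) :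
    polyPull φ (SymmetricAlgebra.ι k _ ξ) = toConv (ξ ∘ₗ φ) := by
  simp [polyPull]
  rfl

/-- The family of functionals `c ↦ φ^*(∂_{φ(m c)} f)` on the right hand side of the chain rule
`polyPull_coderivation`. -/
noncomputable def derivFamily (φ : C →ₗ[k] V) (m : C →ₗ[k] C) (f : 𝒫) : C →ₗ[k] C →ₗ[k] k :=
  (WithConv.linearEquiv k (C →ₗ[k] k)).toLinearMap ∘ₗ
      (polyPull φ).toLinearMap ∘ₗ polyDeriv k V f ∘ₗ φ ∘ₗ m

theorem derivFamily_apply (φ : C →ₗ[k] V) (m : C →ₗ[k] C) (f : 𝒫) (c : C) :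
    derivFamily φ m f c = (polyPull φ (polyDeriv k V f (φ (m c)))).ofConv := rfl

/-- The chain rule `φ^*(f)(m x) = ∑ φ^*(∂_{φ(m x₁)} f)(x₂)` for the coderivation `m`. Both sides are
derivations in `f` with values in the convolution algebra. -/
theorem polyPull_coderivation (φ : C →ₗ[k] V) {m : C →ₗ[k] C} (hm : IsCoderivation m) (f : 𝒫)
    (x : C) : polyPull φ f (m x) = convFamily (derivFamily φ m f) x := by
  induction f using SymmetricAlgebra.induction generalizing x with
  | algebraMap r =>
    have : derivFamily φ m (algebraMap k 𝒫 r) = 0 := by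
      ext c : 1
      rw [derivFamily_apply, polyDeriv_algebraMap]
      simp
    rw [AlgHom.commutes, LinearMap.convAlgebraMap_apply, hm.counit_apply, this, convFamily_zero]
    simp
  | ι ξ =>
    have : ∀ t : C ⊗[k] C, TensorProduct.lift (derivFamily φ m (SymmetricAlgebra.ι k _ ξ)) t =
        ξ (φ (m (TensorProduct.rid k C (counit.lTensor C t)))) := by
      intro t
      induction t with
      | zero => simp
      | tmul a b => simp [derivFamily_apply, mul_comm]
      | add a b ha hb => simp only [map_add, ha, hb]
    rw [polyPull_ι]
    refine Eq.trans ?_ (this (comul x)).symm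
    simp
  | mul f g hf hg =>
    have h1 : ∀ f : 𝒫, (∀ x, polyPull φ f (m x) = convFamily (derivFamily φ m f) x) →
        toConv ((polyPull φ f).ofConv ∘ₗ m) = convFamily (derivFamily φ m f) :=
      fun f h => WithConv.ext (LinearMap.ext h)
    let u (f g : 𝒫) : C →ₗ[k] C →ₗ[k] k := (WithConv.linearEquiv k (C →ₗ[k] k)).toLinearMap ∘ₗ
      LinearMap.mulRight k (polyPull φ f) ∘ₗ
      (polyPull φ).toLinearMap ∘ₗ polyDeriv k V g ∘ₗ φ ∘ₗ m
    have h2 : derivFamily φ m (f * g) = u f g + u g f := by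
      ext c : 1
      rw [derivFamily_apply, polyDeriv_mul, map_add, map_mul, map_mul, mul_comm,
        mul_comm (polyPull φ g)]
      rfl
    rw [map_mul, hm.convMul_apply, h1 f hf, h1 g hg, h2, convFamily_add,
      convFamily_mul (derivFamily φ m g) (u f g) (polyPull φ f) fun _ => rfl,
      convFamily_mul (derivFamily φ m f) (u g f) (polyPull φ g) fun _ => rfl,
      mul_comm (polyPull φ f), add_comm]
    rfl
  | add f g hf hg =>
    have : derivFamily φ m (f + g) = derivFamily φ m f + derivFamily φ m g := by
      ext c : 1
      rw [derivFamily_apply, map_add, LinearMap.add_apply, map_add]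
      rfl
    rw [map_add, this, convFamily_add]
    exact congrArg₂ (· + ·) (hf x) (hg x)

/-- Pulling back is natural with respect to morphisms of coalgebras. -/
theorem polyPull_comp {D : Type*} [AddCommGroup D] [Module k D] [Coalgebra k D] [IsCocomm k D]
    (φ : D →ₗ[k] V) (Φ : C →ₗc[k] D) (f : 𝒫) (x : C) :
    polyPull φ f (Φ x) = polyPull (φ ∘ₗ Φ.toLinearMap) f x := by
  induction f using SymmetricAlgebra.induction generalizing x with
  | algebraMap r =>
    simp only [AlgHom.commutes, LinearMap.convAlgebraMap_apply]
    rw [CoalgHomClass.counit_comp_apply]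
  | ι ξ => simp
  | mul f g hf hg =>
    have h1 : ∀ f : 𝒫, (∀ x, polyPull φ f (Φ x) = polyPull (φ ∘ₗ Φ.toLinearMap) f x) →
        (polyPull φ f).ofConv ∘ₗ Φ.toLinearMap = (polyPull (φ ∘ₗ Φ.toLinearMap) f).ofConv :=
      fun f h => LinearMap.ext h
    have := LinearMap.congr_fun
      (LinearMap.convMul_comp_coalgHom_distrib (polyPull φ f) (polyPull φ g) Φ) x
    rw [h1 f hf, h1 g hg] at this
    rw [map_mul, map_mul]
    exact this
  | add f g hf hg =>
    rw [map_add, map_add]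
    exact congrArg₂ (· + ·) (hf x) (hg x)

end Polynomial

/-! ### The symmetric algebra -/

section SymmetricAlgebra

variable {k : Type*} [Field k] {V : Type*} [AddCommGroup V] [Module k V]

/-- The symmetric algebra is spanned by the elements obtained from `1` by multiplication by vectors. -/
theorem symmetricAlgebra_induction {motive : SymmetricAlgebra k V → Prop} (one : motive 1)
    (ι_mul : ∀ v y, motive y → motive (SymmetricAlgebra.ι k V v * y))
    (smul : ∀ (r : k) y, motive y → motive (r • y))
    (add : ∀ x y, motive x → motive y → motive (x + y)) (x : SymmetricAlgebra k V) : motive x := by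
  suffices ∀ y, motive y → motive (x * y) by simpa using this 1 one
  induction x using SymmetricAlgebra.induction with
  | algebraMap r => intro y hy; rw [← Algebra.smul_def]; exact smul r y hy
  | ι v => exact ι_mul v
  | mul a b ha hb => intro y hy; rw [mul_assoc]; exact ha _ (hb _ hy)
  | add a b ha hb => intro y hy; rw [add_mul]; exact add _ _ (ha _ hy) (hb _ hy)

theorem symDegOne_one (k : Type u) [Field k] (V : Type u) [AddCommGroup V] [Module k V] :
    symDegOne k V 1 = 0 := by
  let _ : Module kᵐᵒᵖ V := Module.compHom V ((RingHom.id k).fromOpposite mul_comm)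
  have : IsCentralScalar k V := ⟨fun _ _ => rfl⟩
  change (SymmetricAlgebra.lift (TrivSqZeroExt.inrHom k V) (1 : SymmetricAlgebra k V)).snd = 0
  rw [map_one]
  rfl

theorem symDegOne_ι_mul {k : Type u} [Field k] {V : Type u} [AddCommGroup V] [Module k V]
    (v : V) (y : SymmetricAlgebra k V) :
    symDegOne k V (SymmetricAlgebra.ι k V v * y) = counit (R := k) y • v := by
  let _ : Module kᵐᵒᵖ V := Module.compHom V ((RingHom.id k).fromOpposite mul_comm)
  have : IsCentralScalar k V := ⟨fun _ _ => rfl⟩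
  have h : (TrivSqZeroExt.fstHom k k V).comp (SymmetricAlgebra.lift (TrivSqZeroExt.inrHom k V)) =
      SymmetricAlgebra.algebraMapInv := by
    ext x
    simp [SymmetricAlgebra.algebraMapInv_ι]
  have hy : (SymmetricAlgebra.lift (TrivSqZeroExt.inrHom k V) y).fst = counit (R := k) y :=
    DFunLike.congr_fun h y
  change (SymmetricAlgebra.lift (TrivSqZeroExt.inrHom k V) (SymmetricAlgebra.ι k V v * y)).snd = _
  rw [map_mul, SymmetricAlgebra.lift_ι_apply, TrivSqZeroExt.snd_mul, hy]
  simp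

theorem comul_ι_mul (v : V) (y : SymmetricAlgebra k V) :
    comul (R := k) (SymmetricAlgebra.ι k V v * y) =
      (LinearMap.mulLeft k (SymmetricAlgebra.ι k V v)).rTensor _ (comul y) +
      (LinearMap.mulLeft k (SymmetricAlgebra.ι k V v)).lTensor _ (comul y) := by
  rw [Bialgebra.comul_mul, SymmetricAlgebra.comul_ι, add_mul]
  congr 1 <;>
  · generalize comul (R := k) y = t
    induction t with
    | zero => simp
    | tmul a b => simp
    | add a b ha hb => simp only [mul_add, map_add, ha, hb]

end SymmetricAlgebra

section Contraction

variable {k : Type u} [Field k] {V : Type u} [AddCommGroup V] [Module k V]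

/-- The derivation `y ↦ ∑ ξ((y₁)₁) y₂` of `Sym(V)` given by a linear form `ξ` on `V`, where `(y₁)₁` is
the degree one part of `y₁`. -/
noncomputable def symContract (ξ : Module.Dual k V) :
    SymmetricAlgebra k V →ₗ[k] SymmetricAlgebra k V :=
  (TensorProduct.lid k _).toLinearMap ∘ₗ (ξ ∘ₗ symDegOne k V).rTensor _ ∘ₗ comul

theorem symContract_one (ξ : Module.Dual k V) : symContract ξ 1 = 0 := by
  simp [symContract, Algebra.TensorProduct.one_def, symDegOne_one]

theorem symContract_ι_mul (ξ : Module.Dual k V) (v : V) (y : SymmetricAlgebra k V) :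
    symContract ξ (SymmetricAlgebra.ι k V v * y) =
      ξ v • y + SymmetricAlgebra.ι k V v * symContract ξ y := by
  have h1 : ∀ t : SymmetricAlgebra k V ⊗[k] SymmetricAlgebra k V,
      TensorProduct.lid k _ ((ξ ∘ₗ symDegOne k V).rTensor _
        ((LinearMap.mulLeft k (SymmetricAlgebra.ι k V v)).rTensor _ t)) =
      ξ v • TensorProduct.lid k _ (counit.rTensor _ t) := by
    intro t
    induction t with
    | zero => simp
    | tmul a b => simp [symDegOne_ι_mul, smul_smul, mul_comm (ξ v)]
    | add a b ha hb => simp only [map_add, ha, hb, smul_add]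
  have h2 : ∀ t : SymmetricAlgebra k V ⊗[k] SymmetricAlgebra k V,
      TensorProduct.lid k _ ((ξ ∘ₗ symDegOne k V).rTensor _
        ((LinearMap.mulLeft k (SymmetricAlgebra.ι k V v)).lTensor _ t)) =
      SymmetricAlgebra.ι k V v * TensorProduct.lid k _ ((ξ ∘ₗ symDegOne k V).rTensor _ t) := by
    intro t
    induction t with
    | zero => simp
    | tmul a b => simp
    | add a b ha hb => simp only [map_add, ha, hb, mul_add]
  simp only [symContract, LinearMap.comp_apply, comul_ι_mul, map_add, LinearEquiv.coe_coe, h1, h2]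
  simp

/-- In coordinates, `symContract` is a partial derivative. -/
theorem pderiv_equivMvPolynomial {I : Type*} (b : Module.Basis I k V) (i : I)
    (y : SymmetricAlgebra k V) :
    SymmetricAlgebra.equivMvPolynomial b (symContract (b.coord i) y) =
      MvPolynomial.pderiv i (SymmetricAlgebra.equivMvPolynomial b y) := by
  have h1 : ∀ v, MvPolynomial.pderiv i (SymmetricAlgebra.equivMvPolynomial b
      (SymmetricAlgebra.ι k V v)) = MvPolynomial.C (b.coord i v) := by
    intro v
    have : (MvPolynomial.pderiv i).toLinearMap ∘ₗ
        (SymmetricAlgebra.equivMvPolynomial b).toLinearMap ∘ₗ SymmetricAlgebra.ι k V =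
        Algebra.linearMap k _ ∘ₗ b.coord i := by
      classical
      refine b.ext fun j => ?_
      simp [MvPolynomial.pderiv_X, Finsupp.single_apply, Pi.single_apply, eq_comm]
    exact LinearMap.congr_fun this v
  induction y using symmetricAlgebra_induction with
  | one => simp [symContract_one]
  | ι_mul v y hy =>
    rw [symContract_ι_mul, map_add, map_mul, map_mul, MvPolynomial.pderiv_mul, h1, hy, map_smul,
      MvPolynomial.smul_eq_C_mul]
  | smul r y hy => simp only [map_smul, hy]; simp
  | add x y hx hy => simp only [map_add, hx, hy]

end Contraction

section MvPolynomial

variable {k : Type*} [Field k] {I : Type*}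

/-- A polynomial with vanishing partial derivatives is constant in characteristic zero. -/
theorem eq_C_of_pderiv_eq_zero [CharZero k] {p : MvPolynomial I k}
    (h : ∀ i, MvPolynomial.pderiv i p = 0) : p = MvPolynomial.C (MvPolynomial.coeff 0 p) := by
  classical
  ext m
  rw [MvPolynomial.coeff_C]
  split_ifs with hm
  · rw [hm]
  · obtain ⟨i, hi⟩ : ∃ i, m i ≠ 0 := by
      by_contra! h'
      exact hm (Finsupp.ext fun i => (h' i).symm)
    have h1 := congrArg (MvPolynomial.coeff (m - Finsupp.single i 1)) (h i)
    have h2 : m - Finsupp.single i 1 + Finsupp.single i 1 = m :=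
      tsub_add_cancel_of_le (by simpa [Nat.one_le_iff_ne_zero] using hi)
    rw [MvPolynomial.coeff_pderiv, h2, MvPolynomial.coeff_zero] at h1
    exact (mul_eq_zero.1 h1).resolve_right (by norm_cast)

/-- The degree of a polynomial plus one, and `0` for the polynomial `0`. -/
noncomputable def degSucc (p : MvPolynomial I k) : ℕ :=
  p.support.sup fun m => m.degree + 1

theorem degSucc_le_iff {p : MvPolynomial I k} {n : ℕ} :
    degSucc p ≤ n ↔ ∀ m, p.coeff m ≠ 0 → m.degree + 1 ≤ n := by
  simp [degSucc]

theorem degSucc_pderiv_add_one_le {p : MvPolynomial I k} (hp : p ≠ 0) (i : I) :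
    degSucc (MvPolynomial.pderiv i p) + 1 ≤ degSucc p := by
  have h0 : 1 ≤ degSucc p := by
    obtain ⟨m, hm⟩ := MvPolynomial.ne_zero_iff.1 hp
    have := degSucc_le_iff.1 le_rfl m hm
    omega
  rw [← Nat.le_sub_iff_add_le h0, degSucc_le_iff]
  intro m hm
  rw [MvPolynomial.coeff_pderiv] at hm
  have := degSucc_le_iff.1 le_rfl _ (left_ne_zero_of_mul hm)
  rw [map_add, Finsupp.degree_single] at this
  omega

theorem degSucc_smul_add_pderiv_le (p : MvPolynomial I k) (i : I) (r : k) :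
    degSucc (r • p + MvPolynomial.pderiv i p) ≤ degSucc p := by
  rw [degSucc_le_iff]
  intro m hm
  rw [MvPolynomial.coeff_add, MvPolynomial.coeff_smul, MvPolynomial.coeff_pderiv] at hm
  by_cases h : p.coeff m = 0
  · have h' : p.coeff (m + Finsupp.single i 1) ≠ 0 := fun h' => hm (by simp [h, h'])
    have := degSucc_le_iff.1 le_rfl _ h'
    rw [map_add] at this
    omega
  · exact degSucc_le_iff.1 le_rfl _ h

end MvPolynomial

/-! ### The coalgebra `!V` -/

section Bang

variable {k : Type u} [Field k] {V : Type u} [AddCommGroup V] [Module k V]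

noncomputable instance : IsCocomm k (Bang k V) :=
  inferInstanceAs (IsCocomm k (V →₀ SymmetricAlgebra k V))

theorem bang_hom_ext {M : Type*} [AddCommGroup M] [Module k M] {f g : Bang k V →ₗ[k] M}
    (h : ∀ P y, f (symIncl k P y) = g (symIncl k P y)) : f = g :=
  Finsupp.lhom_ext' fun P => LinearMap.ext (h P)

theorem comul_symIncl (P : V) (y : SymmetricAlgebra k V) :
    comul (R := k) (symIncl k P y) = TensorProduct.map (symIncl k P) (symIncl k P) (comul y) :=
  Finsupp.comul_single k V _ P y

theorem counit_symIncl (P : V) (y : SymmetricAlgebra k V) :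
    counit (R := k) (symIncl k P y) = counit (R := k) y :=
  Finsupp.counit_single k V _ P y

theorem bangCounit_symIncl (P : V) (y : SymmetricAlgebra k V) :
    bangCounit k V (symIncl k P y) = counit (R := k) y • P + symDegOne k V y :=
  Finsupp.lsum_single k _ P y

/-- Multiplication by the vector `v` on each summand `Sym_P(V)` of `!V`. -/
noncomputable def bangMul (v : V) : Bang k V →ₗ[k] Bang k V :=
  Finsupp.mapRange.linearMap (LinearMap.mulLeft k (SymmetricAlgebra.ι k V v))

theorem bangMul_symIncl (v P : V) (y : SymmetricAlgebra k V) :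
    bangMul v (symIncl k P y) = symIncl k P (SymmetricAlgebra.ι k V v * y) :=
  Finsupp.mapRange_single (hf := map_zero (LinearMap.mulLeft k (SymmetricAlgebra.ι k V v)))

theorem isCoderivation_bangMul (v : V) : IsCoderivation (bangMul (k := k) v) := by
  refine bang_hom_ext fun P y => ?_
  simp only [LinearMap.comp_apply, bangMul_symIncl, comul_symIncl, comul_ι_mul, map_add]
  generalize comul (R := k) y = t
  induction t with
  | zero => simp
  | tmul a b => simp [bangMul_symIncl]
  | add a b ha hb =>
    simp only [map_add] at ha hb ⊢
    rw [add_add_add_comm, ha, hb]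

theorem bangCounit_bangMul (v : V) (x : Bang k V) :
    bangCounit k V (bangMul v x) = counit (R := k) x • v := by
  have : bangCounit k V ∘ₗ bangMul v = LinearMap.toSpanSingleton k V v ∘ₗ counit := by
    refine bang_hom_ext fun P y => ?_
    simp [bangMul_symIncl, bangCounit_symIncl, symDegOne_ι_mul, counit_symIncl]
  exact LinearMap.congr_fun this x

/-- `bangMul v` is dual to the derivative in direction `v`. -/
theorem polyPull_bangMul (f : SymmetricAlgebra k (Module.Dual k V)) (v : V) (x : Bang k V) :
    polyPull (bangCounit k V) f (bangMul v x) =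
      polyPull (bangCounit k V) (polyDeriv k V f v) x := by
  rw [polyPull_coderivation _ (isCoderivation_bangMul v)]
  have : ∀ t : Bang k V ⊗[k] Bang k V,
      TensorProduct.lift (derivFamily (bangCounit k V) (bangMul v) f) t =
      polyPull (bangCounit k V) (polyDeriv k V f v)
        (TensorProduct.lid k _ (counit.rTensor _ t)) := by
    intro t
    induction t with
    | zero => simp
    | tmul a b => simp [derivFamily_apply, bangCounit_bangMul]
    | add a b ha hb => simp only [map_add, ha, hb]
  refine (this (comul x)).trans ?_
  simp

theorem isGroupLikeElem_symIncl_one (P : V) : IsGroupLikeElem k (symIncl k P 1) where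
  counit_eq_one := by rw [counit_symIncl, Bialgebra.counit_one]
  comul_eq_tmul_self := by
    rw [comul_symIncl, Bialgebra.comul_one, Algebra.TensorProduct.one_def, TensorProduct.map_tmul]

/-! ### Polynomial functions separate the elements of `!V` -/

/-- The action `x ↦ ∑ ξ(d x₁) x₂` of a linear form `ξ` on `!V`. -/
noncomputable def bangContract (ξ : Module.Dual k V) : Bang k V →ₗ[k] Bang k V :=
  (TensorProduct.lid k _).toLinearMap ∘ₗ (ξ ∘ₗ bangCounit k V).rTensor _ ∘ₗ comul

theorem polyPull_bangContract (ξ : Module.Dual k V) (f : SymmetricAlgebra k (Module.Dual k V))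
    (x : Bang k V) : polyPull (bangCounit k V) f (bangContract ξ x) =
      polyPull (bangCounit k V) (SymmetricAlgebra.ι k _ ξ * f) x := by
  rw [map_mul, polyPull_ι, LinearMap.convMul_apply]
  simp only [bangContract, LinearMap.comp_apply, LinearEquiv.coe_coe]
  generalize comul (R := k) x = t
  induction t with
  | zero => simp
  | tmul a b => simp
  | add a b ha hb => simp only [map_add, ha, hb]

theorem bangContract_symIncl (ξ : Module.Dual k V) (P : V) (y : SymmetricAlgebra k V) :
    bangContract ξ (symIncl k P y) = symIncl k P (ξ P • y + symContract ξ y) := by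
  have : ∀ t : SymmetricAlgebra k V ⊗[k] SymmetricAlgebra k V,
      TensorProduct.lid k _ ((ξ ∘ₗ bangCounit k V).rTensor _
        (TensorProduct.map (symIncl k P) (symIncl k P) t)) =
      symIncl k P (ξ P • TensorProduct.lid k _ (counit.rTensor _ t) +
        TensorProduct.lid k _ ((ξ ∘ₗ symDegOne k V).rTensor _ t)) := by
    intro t
    induction t with
    | zero => simp
    | tmul a b => simp [bangCounit_symIncl, add_smul, smul_smul, mul_comm]
    | add a b ha hb =>
      simp only [map_add, smul_add] at ha hb ⊢
      rw [add_add_add_comm, ha, hb]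
  simp only [bangContract, LinearMap.comp_apply, LinearEquiv.coe_coe, comul_symIncl, this]
  simp [symContract]

/-- The component of `x : !V` in `Sym_P(V)`. -/
noncomputable def bangComp (P : V) : Bang k V →ₗ[k] SymmetricAlgebra k V :=
  Finsupp.lapply (R := k) P

theorem bangComp_bangContract (ξ : Module.Dual k V) (P : V) (x : Bang k V) :
    bangComp P (bangContract ξ x) = ξ P • bangComp P x + symContract ξ (bangComp P x) := by
  have : bangComp P ∘ₗ bangContract ξ =
      (ξ P • LinearMap.id + symContract ξ) ∘ₗ bangComp P := by
    classical
    refine bang_hom_ext fun Q y => ?_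
    rw [LinearMap.comp_apply, bangContract_symIncl, LinearMap.comp_apply]
    have h : ∀ y, bangComp P (symIncl k Q y) = if Q = P then y else 0 :=
      fun y => Finsupp.single_apply
    rw [h, h]
    split_ifs with hQ
    · rw [hQ]; rfl
    · simp
  exact LinearMap.congr_fun this x

/-- Polynomial functions separate the elements of `!V`. The functionals vanishing on all polynomial
functions form a subspace stable under `bangContract`; by lowering degrees, a nonzero element of it
would give a nonzero multiple of some `|∅⟩_P`, on which the function `1` does not vanish. -/
theorem bang_eq_zero_of_polyPull [CharZero k] (x : Bang k V)
    (hx : ∀ f, polyPull (bangCounit k V) f x = 0) : x = 0 := by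
  obtain ⟨I, ⟨b⟩⟩ : ∃ I : Type u, Nonempty (Module.Basis I k V) :=
    ⟨_, ⟨Module.Basis.ofVectorSpace k V⟩⟩
  let e := SymmetricAlgebra.equivMvPolynomial b
  let s (x : Bang k V) : Finset V := Finsupp.support (x : V →₀ SymmetricAlgebra k V)
  have hs : ∀ x P, P ∈ s x ↔ bangComp P x ≠ 0 := fun x P => Finsupp.mem_support_iff
  let μ (x : Bang k V) : ℕ := ∑ P ∈ s x, degSucc (e (bangComp P x))
  induction hn : μ x using Nat.strong_induction_on generalizing x with
  | _ n ih =>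
  subst hn
  -- the operator `b*_i - b*_i(P)` lowers the degree at `P` and does not raise it elsewhere
  have key : ∀ P ∈ s x, ∀ i, bangContract (b.coord i) x - b.coord i P • x = 0 := by
    intro P hP i
    let z := bangContract (b.coord i) x - b.coord i P • x
    have hz : ∀ Q, e (bangComp Q z) = (b.coord i Q - b.coord i P) • e (bangComp Q x) +
        MvPolynomial.pderiv i (e (bangComp Q x)) := by
      intro Q
      rw [map_sub, bangComp_bangContract, map_sub, map_add, pderiv_equivMvPolynomial, map_smul,
        map_smul, map_smul, sub_smul]
      abel
    have hle : ∀ Q, degSucc (e (bangComp Q z)) ≤ degSucc (e (bangComp Q x)) :=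
      fun Q => (hz Q).symm ▸ degSucc_smul_add_pderiv_le _ _ _
    have hsub : s z ⊆ s x := by
      intro Q hQ
      rw [hs] at hQ ⊢
      intro h
      refine hQ (e.injective ?_)
      rw [hz, h]
      simp
    refine ih (μ z) ?_ z (fun f => ?_) rfl
    · have h1 : μ z ≤ ∑ Q ∈ s x, degSucc (e (bangComp Q z)) :=
        Finset.sum_le_sum_of_subset hsub
      refine h1.trans_lt (Finset.sum_lt_sum (fun Q _ => hle Q) ⟨P, hP, ?_⟩)
      have h2 : e (bangComp P x) ≠ 0 := fun h =>
        (hs x P).1 hP (e.injective (h.trans (map_zero e).symm))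
      rw [hz, sub_self, zero_smul, zero_add]
      exact degSucc_pderiv_add_one_le h2 i
    · -- the pairing with `z` vanishes, as the annihilator of `Sym(V*)` is stable under `bangContract`
      have : polyPull (bangCounit k V) f z =
          polyPull (bangCounit k V) f (bangContract (b.coord i) x) -
          b.coord i P • polyPull (bangCounit k V) f x := by
        simp [z]
      rw [this, polyPull_bangContract, hx, hx]
      simp
  by_contra hx0
  obtain ⟨P, hP⟩ : (s x).Nonempty := Finsupp.support_nonempty_iff.2 hx0
  have hcomp : ∀ Q i, (b.coord i Q - b.coord i P) • e (bangComp Q x) +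
      MvPolynomial.pderiv i (e (bangComp Q x)) = 0 := by
    intro Q i
    have := congrArg (fun z => e (bangComp Q z)) (key P hP i)
    simp only [map_sub, map_add, bangComp_bangContract, map_smul, e, pderiv_equivMvPolynomial,
      map_zero] at this
    rw [← this, sub_smul]
    abel
  -- by `key`, all components are constant, and `x` is supported at the single point `P`
  have hconst : ∀ Q ∈ s x, ∀ i, MvPolynomial.pderiv i (e (bangComp Q x)) = 0 := by
    intro Q hQ i
    have := congrArg (fun z => e (bangComp Q z)) (key Q hQ i)
    simpa [bangComp_bangContract, e, pderiv_equivMvPolynomial] using this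
  have hPx : ∀ Q ∈ s x, Q = P := by
    intro Q hQ
    refine b.ext_elem fun i => ?_
    have h1 := hcomp Q i
    rw [hconst Q hQ i, add_zero, smul_eq_zero] at h1
    refine sub_eq_zero.1 (h1.resolve_right fun h => ?_)
    exact (hs x Q).1 hQ (e.injective (h.trans (map_zero e).symm))
  obtain ⟨c, hc⟩ : ∃ c, e (bangComp P x) = MvPolynomial.C c :=
    ⟨_, eq_C_of_pderiv_eq_zero (hconst P hP)⟩
  have hc' : bangComp P x = algebraMap k _ c := e.injective (by rw [hc, AlgEquiv.commutes]; rfl)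
  have hxP : x = symIncl k P (bangComp P x) := by
    refine Finsupp.ext fun Q => ?_
    change bangComp Q x = Finsupp.single P _ Q
    classical
    rw [Finsupp.single_apply]
    split_ifs with h
    · rw [h]
    · by_contra h'
      exact h (hPx Q ((hs x Q).2 h')).symm
  have h1 := hx 1
  rw [map_one, LinearMap.convOne_apply, hxP, counit_symIncl, hc', Bialgebra.counit_algebraMap] at h1
  exact (hs x P).1 hP (by rw [hc', show c = 0 from h1, map_zero])

end Bang

/-! ### The universal property of `!V` -/

section Generated

variable {k : Type*} [Field k] {C D : Type*} [AddCommGroup C] [Module k C] [Coalgebra k C]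
  [AddCommGroup D] [Module k D] [Coalgebra k D]

/-- The elements obtained from group-like elements by applying coderivations. -/
inductive CoderivGen : C → Prop
  | groupLike {g : C} (hg : IsGroupLikeElem k g) : CoderivGen g
  | coderiv {m : C →ₗ[k] C} (hm : IsCoderivation m) {x : C} : CoderivGen x → CoderivGen (m x)

variable (k C) in
/-- A coalgebra is generated by coderivations if it is spanned by the elements obtained from
group-like elements by applying coderivations. -/
def CoderivGenerated : Prop :=
  Submodule.span k {x : C | CoderivGen (k := k) x} = ⊤

theorem IsCoderivation.rTensor {m : C →ₗ[k] C} (hm : IsCoderivation m) :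
    IsCoderivation (m.rTensor D) := by
  refine TensorProduct.ext' fun x y => ?_
  simp only [LinearMap.comp_apply, LinearMap.rTensor_tmul, TensorProduct.comul_tmul,
    hm.comul_apply, TensorProduct.add_tmul, map_add, LinearMap.add_apply]
  generalize comul (R := k) x = s
  generalize comul (R := k) y = t
  congr 1 <;>
  · induction s with
    | zero => simp
    | add a b ha hb => simp only [map_add, TensorProduct.add_tmul, ha, hb]
    | tmul a b =>
      induction t with
      | zero => simp
      | add c d hc hd => simp only [map_add, TensorProduct.tmul_add, hc, hd]
      | tmul c d => simp

theorem IsCoderivation.lTensor {m : D →ₗ[k] D} (hm : IsCoderivation m) :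
    IsCoderivation (m.lTensor C) := by
  refine TensorProduct.ext' fun x y => ?_
  simp only [LinearMap.comp_apply, LinearMap.lTensor_tmul, TensorProduct.comul_tmul,
    hm.comul_apply, TensorProduct.tmul_add, map_add, LinearMap.add_apply]
  generalize comul (R := k) x = s
  generalize comul (R := k) y = t
  congr 1 <;>
  · induction s with
    | zero => simp
    | add a b ha hb => simp only [map_add, TensorProduct.add_tmul, ha, hb]
    | tmul a b =>
      induction t with
      | zero => simp
      | add c d hc hd => simp only [map_add, TensorProduct.tmul_add, hc, hd]
      | tmul c d => simp

theorem CoderivGen.tmul {x : C} {y : D} (hx : CoderivGen (k := k) x) (hy : CoderivGen (k := k) y) :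
    CoderivGen (k := k) (x ⊗ₜ[k] y) := by
  induction hx with
  | coderiv hm _ ih => exact CoderivGen.coderiv (hm.rTensor (D := D)) ih
  | groupLike hg =>
    induction hy with
    | coderiv hm _ ih => exact CoderivGen.coderiv (hm.lTensor (C := C)) ih
    | groupLike hg' =>
      refine CoderivGen.groupLike ⟨?_, ?_⟩
      · simp [hg.counit_eq_one, hg'.counit_eq_one]
      · simp [hg.comul_eq_tmul_self, hg'.comul_eq_tmul_self]

theorem CoderivGenerated.tensorProduct (hC : CoderivGenerated k C) (hD : CoderivGenerated k D) :
    CoderivGenerated k (C ⊗[k] D) := by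
  rw [CoderivGenerated, eq_top_iff, ← TensorProduct.span_tmul_eq_top, Submodule.span_le]
  rintro _ ⟨x, y, rfl⟩
  have hx : x ∈ Submodule.span k {x : C | CoderivGen (k := k) x} := hC ▸ Submodule.mem_top
  have hy : y ∈ Submodule.span k {x : D | CoderivGen (k := k) x} := hD ▸ Submodule.mem_top
  have := Submodule.apply_mem_map₂ (TensorProduct.mk k C D) hx hy
  rw [Submodule.map₂_span_span] at this
  refine Submodule.span_mono ?_ this
  rintro _ ⟨x, hx, y, hy, rfl⟩
  exact hx.tmul hy

theorem coderivGenerated_self : CoderivGenerated k k := by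
  rw [CoderivGenerated, eq_top_iff]
  rintro x -
  rw [← mul_one x, ← smul_eq_mul]
  exact Submodule.smul_mem _ _ (Submodule.subset_span (.groupLike (by simp)))

theorem coderivGenerated_bang {k : Type u} [Field k] {V : Type u} [AddCommGroup V] [Module k V] :
    CoderivGenerated k (Bang k V) := by
  set U := Submodule.span k {x : Bang k V | CoderivGen (k := k) x} with hU
  have hmul : ∀ v : V, ∀ x ∈ U, bangMul v x ∈ U := by
    intro v x hx
    induction hx using Submodule.span_induction with
    | mem x hx => exact Submodule.subset_span (hx.coderiv (isCoderivation_bangMul v))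
    | zero => simp
    | add x y _ _ hx hy => rw [map_add]; exact add_mem hx hy
    | smul r x _ hx => rw [map_smul]; exact U.smul_mem r hx
  have h : ∀ P y, symIncl k P y ∈ U := by
    intro P y
    induction y using symmetricAlgebra_induction with
    | one => exact Submodule.subset_span (.groupLike (isGroupLikeElem_symIncl_one P))
    | ι_mul v y hy => rw [← bangMul_symIncl]; exact hmul v _ hy
    | smul r y hy => rw [map_smul]; exact U.smul_mem r hy
    | add x y hx hy => rw [map_add]; exact add_mem hx hy
  have h' : U.mkQ = 0 := bang_hom_ext fun P y => (Submodule.Quotient.mk_eq_zero U).2 (h P y)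
  rw [CoderivGenerated, ← hU, ← Submodule.ker_mkQ U, h', LinearMap.ker_zero]

end Generated

section TensorSeparation

variable {k : Type*} [Field k] {U : Type*} [AddCommGroup U] [Module k U]

/-- If a family of functionals separates the elements of `U`, then its products separate the elements
of `U ⊗ U`. -/
theorem tensor_eq_zero_of_separating {ι : Type*} (p : ι → Module.Dual k U)
    (hp : ∀ u, (∀ i, p i u = 0) → u = 0) (x : U ⊗[k] U)
    (hx : ∀ i j, LinearMap.mul' k k (TensorProduct.map (p i) (p j) x) = 0) : x = 0 := by
  have h1 : ∀ j, TensorProduct.rid k U ((p j).lTensor U x) = 0 := by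
    intro j
    refine hp _ fun i => (Eq.trans ?_ (hx i j))
    clear hx
    induction x with
    | zero => simp
    | tmul a b => simp [mul_comm]
    | add a b ha hb => simp only [map_add, ha, hb]
  classical
  let b := Module.Basis.ofVectorSpace k U
  refine (TensorProduct.equivFinsuppOfBasisLeft b).injective ?_
  rw [map_zero]
  ext l
  refine hp _ fun j => ?_
  have h2 := congrArg (b.coord l) (h1 j)
  rw [map_zero] at h2
  refine Eq.trans ?_ h2
  clear h1 h2 hx
  induction x with
  | zero => simp
  | tmul a b => simp [mul_comm]
  | add a b ha hb => simp only [map_add, Finsupp.add_apply, ha, hb]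

end TensorSeparation
section UniversalProperty

variable {k : Type u} [Field k] {V : Type u} [AddCommGroup V] [Module k V]

theorem bang_tensor_eq_zero_of_polyPull [CharZero k] (x : Bang k V ⊗[k] Bang k V)
    (hx : ∀ f g, LinearMap.mul' k k (TensorProduct.map (polyPull (bangCounit k V) f).ofConv
      (polyPull (bangCounit k V) g).ofConv x) = 0) : x = 0 :=
  tensor_eq_zero_of_separating (fun f => (polyPull (bangCounit k V) f).ofConv)
    bang_eq_zero_of_polyPull x hx

variable {C : Type u} [AddCommGroup C] [Module k C] [Coalgebra k C] [IsCocomm k C]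

/-- Two morphisms of coalgebras to `!V` with the same composition with `d` agree. -/
theorem bang_coalgHom_ext [CharZero k] {Φ Ψ : C →ₗc[k] Bang k V}
    (h : bangCounit k V ∘ₗ Φ.toLinearMap = bangCounit k V ∘ₗ Ψ.toLinearMap) : Φ = Ψ := by
  ext x
  refine sub_eq_zero.1 (bang_eq_zero_of_polyPull _ fun f => ?_)
  rw [map_sub, polyPull_comp, polyPull_comp, h, sub_self]

/-- The functionals `f ↦ φ^*(f)(x)` on polynomial functions, for `x` in a coalgebra. -/
noncomputable def polyPullFlip (φ : C →ₗ[k] V) :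
    C →ₗ[k] SymmetricAlgebra k (Module.Dual k V) →ₗ[k] k :=
  ((WithConv.linearEquiv k (C →ₗ[k] k)).toLinearMap ∘ₗ (polyPull φ).toLinearMap).flip

theorem polyPullFlip_apply (φ : C →ₗ[k] V) (x : C) (f : SymmetricAlgebra k (Module.Dual k V)) :
    polyPullFlip φ x f = polyPull φ f x := rfl

/-- If a subcoalgebra `U` is sent by `φ` to functionals represented by elements of `!V`, then so is its
image under a coderivation: by the chain rule, `m x` is represented by `∑ φ(m x₁) · y(x₂)` if
`y(x₂)` represents `x₂`. -/
theorem polyPullFlip_coderivation_mem (φ : C →ₗ[k] V) {m : C →ₗ[k] C} (hm : IsCoderivation m)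
    {U : Submodule k C}
    (hU : U ≤ (LinearMap.range (polyPullFlip (bangCounit k V))).comap (polyPullFlip φ)) {x : C}
    (hx : comul (R := k) x ∈ LinearMap.range (TensorProduct.map U.subtype U.subtype)) :
    polyPullFlip φ (m x) ∈ LinearMap.range (polyPullFlip (bangCounit k V)) := by
  obtain ⟨t, ht⟩ := hx
  have h : ∀ t : U ⊗[k] U, ∃ y : Bang k V, ∀ f, polyPull (bangCounit k V) f y =
      TensorProduct.lift (derivFamily φ m f) (TensorProduct.map U.subtype U.subtype t) := by
    intro t
    induction t with
    | zero => exact ⟨0, fun f => by simp⟩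
    | tmul a b =>
      obtain ⟨y, hy⟩ := hU b.2
      refine ⟨bangMul (φ (m a)) y, fun f => ?_⟩
      rw [polyPull_bangMul, ← polyPullFlip_apply, hy]
      simp [polyPullFlip_apply, derivFamily_apply]
    | add s t hs ht =>
      obtain ⟨y, hy⟩ := hs
      obtain ⟨z, hz⟩ := ht
      exact ⟨y + z, fun f => by simp only [map_add, hy, hz]⟩
  obtain ⟨y, hy⟩ := h t
  refine ⟨y, LinearMap.ext fun f => ?_⟩
  rw [polyPullFlip_apply, polyPullFlip_apply, hy, polyPull_coderivation φ hm, ht]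
  rfl

/-- An element generated by coderivations lies in a subcoalgebra all of whose elements give functionals
represented by elements of `!V`. -/
theorem CoderivGen.exists_subcoalgebra (φ : C →ₗ[k] V) {x : C} (hx : CoderivGen (k := k) x) :
    ∃ U : Submodule k C, x ∈ U ∧
      (∀ y ∈ U, comul (R := k) y ∈ LinearMap.range (TensorProduct.map U.subtype U.subtype)) ∧
      U ≤ (LinearMap.range (polyPullFlip (bangCounit k V))).comap (polyPullFlip φ) := by
  induction hx with
  | @groupLike g hg =>
    refine ⟨Submodule.span k {g}, Submodule.mem_span_singleton_self g, fun y hy => ?_, ?_⟩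
    · obtain ⟨r, rfl⟩ := Submodule.mem_span_singleton.1 hy
      rw [map_smul, hg.comul_eq_tmul_self]
      refine Submodule.smul_mem _ _ ⟨⟨g, Submodule.mem_span_singleton_self g⟩ ⊗ₜ
        ⟨g, Submodule.mem_span_singleton_self g⟩, rfl⟩
    · rw [Submodule.span_singleton_le_iff_mem]
      -- evaluation at a group-like element is multiplicative, like evaluation at a point
      refine ⟨symIncl k (φ g) 1, LinearMap.ext fun f => ?_⟩
      rw [polyPullFlip_apply, polyPullFlip_apply]
      have hP := isGroupLikeElem_symIncl_one (k := k) (φ g)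
      induction f using SymmetricAlgebra.induction with
      | algebraMap r => simp [hg.counit_eq_one, hP.counit_eq_one]
      | ι ξ => simp [bangCounit_symIncl, symDegOne_one]
      | mul f f' hf hf' => simp [hg.comul_eq_tmul_self, hP.comul_eq_tmul_self, hf, hf']
      | add f f' hf hf' =>
        simp only [map_add]
        exact congrArg₂ (· + ·) hf hf'
  | @coderiv m hm x _ ih =>
    obtain ⟨U, hxU, hUΔ, hU⟩ := ih
    have hle : ∀ {U₁ U₂ W₁ W₂ : Submodule k C}, U₁ ≤ W₁ → U₂ ≤ W₂ →
        LinearMap.range (TensorProduct.map U₁.subtype U₂.subtype) ≤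
          LinearMap.range (TensorProduct.map W₁.subtype W₂.subtype) := by
      rintro U₁ U₂ W₁ W₂ h₁ h₂ _ ⟨t, rfl⟩
      refine ⟨TensorProduct.map (Submodule.inclusion h₁) (Submodule.inclusion h₂) t, ?_⟩
      rw [← LinearMap.comp_apply, ← TensorProduct.map_comp]
      rfl
    refine ⟨U ⊔ U.map m, Submodule.mem_sup_right ⟨x, hxU, rfl⟩, fun y hy => ?_, ?_⟩
    · obtain ⟨a, ha, _, ⟨b, hb, rfl⟩, rfl⟩ := Submodule.mem_sup.1 hy
      rw [map_add, hm.comul_apply]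
      obtain ⟨t, ht⟩ := hUΔ b hb
      have hr : m.rTensor C (comul b) ∈
          LinearMap.range (TensorProduct.map (U.map m).subtype U.subtype) :=
        ⟨TensorProduct.map (m.submoduleMap U) LinearMap.id t, by
          rw [← ht, LinearMap.rTensor, ← LinearMap.comp_apply, ← LinearMap.comp_apply,
            ← TensorProduct.map_comp, ← TensorProduct.map_comp]
          rfl⟩
      have hl : m.lTensor C (comul b) ∈
          LinearMap.range (TensorProduct.map U.subtype (U.map m).subtype) :=
        ⟨TensorProduct.map LinearMap.id (m.submoduleMap U) t, by
          rw [← ht, LinearMap.lTensor, ← LinearMap.comp_apply, ← LinearMap.comp_apply,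
            ← TensorProduct.map_comp, ← TensorProduct.map_comp]
          rfl⟩
      exact add_mem (hle le_sup_left le_sup_left (hUΔ a ha))
        (add_mem (hle le_sup_right le_sup_left hr) (hle le_sup_left le_sup_right hl))
    · refine sup_le hU ?_
      rintro _ ⟨b, hb, rfl⟩
      exact polyPullFlip_coderivation_mem φ hm hU (hUΔ b hb)

/-- The universal property of `!V` for cocommutative coalgebras generated by coderivations. -/
theorem CoderivGenerated.existsUnique_coalgHom [CharZero k] (hC : CoderivGenerated k C)
    (φ : C →ₗ[k] V) : ∃! Φ : C →ₗc[k] Bang k V, bangCounit k V ∘ₗ Φ.toLinearMap = φ := by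
  have hinj : Function.Injective (polyPullFlip (bangCounit k V)) := by
    rw [injective_iff_map_eq_zero]
    exact fun x hx => bang_eq_zero_of_polyPull x fun f => LinearMap.congr_fun hx f
  have hrange : ∀ x, polyPullFlip φ x ∈ LinearMap.range (polyPullFlip (bangCounit k V)) := by
    intro x
    have hx : x ∈ Submodule.span k {x : C | CoderivGen (k := k) x} := hC ▸ Submodule.mem_top
    have hle : Submodule.span k {x : C | CoderivGen (k := k) x} ≤
        (LinearMap.range (polyPullFlip (bangCounit k V))).comap (polyPullFlip φ) := by
      refine Submodule.span_le.2 fun x hx => ?_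
      obtain ⟨U, hxU, -, hU⟩ := CoderivGen.exists_subcoalgebra φ hx
      exact hU hxU
    exact hle hx
  let Φ : C →ₗ[k] Bang k V :=
    (LinearEquiv.ofInjective _ hinj).symm.toLinearMap ∘ₗ (polyPullFlip φ).codRestrict _ hrange
  have hΦ : ∀ f x, polyPull (bangCounit k V) f (Φ x) = polyPull φ f x := by
    intro f x
    have := LinearEquiv.apply_symm_apply (LinearEquiv.ofInjective _ hinj)
      ⟨polyPullFlip φ x, hrange x⟩
    exact LinearMap.congr_fun (congrArg Subtype.val this) f
  have hε : counit (R := k) ∘ₗ Φ = counit := by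
    ext x
    have := hΦ 1 x
    simpa using this
  have hΔ : TensorProduct.map Φ Φ ∘ₗ comul = comul (R := k) ∘ₗ Φ := by
    ext x
    refine sub_eq_zero.1 (bang_tensor_eq_zero_of_polyPull _ fun f g => ?_)
    have h1 : ∀ t : C ⊗[k] C, TensorProduct.map (polyPull (bangCounit k V) f).ofConv
        (polyPull (bangCounit k V) g).ofConv (TensorProduct.map Φ Φ t) =
        TensorProduct.map (polyPull φ f).ofConv (polyPull φ g).ofConv t := by
      intro t
      induction t with
      | zero => simp
      | tmul a b => simp [hΦ]
      | add a b ha hb => simp only [map_add, ha, hb]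
    have h2 := hΦ (f * g) x
    rw [map_mul, map_mul, LinearMap.convMul_apply, LinearMap.convMul_apply] at h2
    rw [map_sub, map_sub, LinearMap.comp_apply, LinearMap.comp_apply, h1, h2, sub_self]
  have hd : bangCounit k V ∘ₗ Φ = φ := by
    refine LinearMap.ext fun x => ?_
    rw [← sub_eq_zero, ← Module.forall_dual_apply_eq_zero_iff k]
    intro ξ
    have := hΦ (SymmetricAlgebra.ι k _ ξ) x
    rw [polyPull_ι, polyPull_ι] at this
    rw [map_sub, sub_eq_zero]
    exact this
  exact ⟨{ Φ with counit_comp := hε, map_comp_comul := hΔ }, hd,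
    fun Ψ hΨ => bang_coalgHom_ext (hΨ.trans hd.symm)⟩

/-- The lift of `φ` as a morphism of coalgebras. -/
theorem CoderivGenerated.exists_cofreeLift [CharZero k] (hC : CoderivGenerated k C)
    (φ : C →ₗ[k] V) : ∃ Φ : C →ₗc[k] Bang k V, Φ.toLinearMap = cofreeLift k φ ∧
      bangCounit k V ∘ₗ Φ.toLinearMap = φ := by
  have h := hC.existsUnique_coalgHom φ
  refine ⟨h.choose, ?_, h.choose_spec.1⟩
  rw [cofreeLift, dif_pos h]

/-- A morphism of coalgebras over `φ` is the lift of `φ`. -/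
theorem CoderivGenerated.eq_cofreeLift [CharZero k] (hC : CoderivGenerated k C)
    {φ : C →ₗ[k] V} (Ψ : C →ₗc[k] Bang k V) (hΨ : bangCounit k V ∘ₗ Ψ.toLinearMap = φ) :
    cofreeLift k φ = Ψ.toLinearMap := by
  obtain ⟨Φ, h1, h2⟩ := hC.exists_cofreeLift φ
  rw [← h1, bang_coalgHom_ext (h2.trans hΨ.symm)]

end UniversalProperty

section Calculus

variable {k : Type u} [Field k] {α : Type w} {V : α → ModuleCat.{u} k}

/-! ### Elements of denotations -/

/-- The tensor `γ ⊗ δ` in `⟦Γ, Δ⟧`. -/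
noncomputable def tm {Γ Δ : Ctx α} : Γ.den V →ₗ[k] Δ.den V →ₗ[k] (Γ ⨾ Δ).den V :=
  TensorProduct.mk k (Γ.den V) (Δ.den V)

/-- An element of `⟦A⟧` as an element of the denotation of the context `A`. -/
noncomputable def sg {A : Formula α} : A.den V →ₗ[k] (Ctx.single A).den V := LinearMap.id

variable (V) in
/-- The unit `1` of the denotation `k` of the empty context. -/
noncomputable def un : (Ctx.nil : Ctx α).den V := (1 : k)

/-- The tensor `a ⊗ b` in `⟦A ⊗ B⟧`. -/
noncomputable def pr {A B : Formula α} : A.den V →ₗ[k] B.den V →ₗ[k] (A.tensor B).den V :=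
  TensorProduct.mk k (A.den V) (B.den V)

/-- The pair `(a, b)` in `⟦A & B⟧`. -/
noncomputable def cj {A B : Formula α} (a : A.den V) (b : B.den V) : (A.conj B).den V := (a, b)

/-- The first projection of `⟦A & B⟧`. -/
noncomputable def cfst {A B : Formula α} : (A.conj B).den V →ₗ[k] A.den V :=
  LinearMap.fst k (A.den V) (B.den V)

/-- The second projection of `⟦A & B⟧`. -/
noncomputable def csnd {A B : Formula α} : (A.conj B).den V →ₗ[k] B.den V :=
  LinearMap.snd k (A.den V) (B.den V)

/-- Application of an element of `⟦A ⊸ B⟧`. -/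
noncomputable def app {A B : Formula α} : (A.limp B).den V →ₗ[k] A.den V →ₗ[k] B.den V :=
  LinearMap.id

/-- The universal map `⟦!A⟧ → ⟦A⟧`. -/
noncomputable def derB {A : Formula α} : A.bang.den V →ₗ[k] A.den V :=
  bangCounit k (A.den V)

/-- The comultiplication `⟦!A⟧ → ⟦!A, !A⟧`. -/
noncomputable def dup {A : Formula α} :
    A.bang.den V →ₗ[k] (Ctx.single A.bang ⨾ Ctx.single A.bang).den V :=
  comul (R := k) (A := Bang k (A.den V))

/-- The counit `⟦!A⟧ → k`. -/
noncomputable def epsB {A : Formula α} : A.bang.den V →ₗ[k] k :=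
  counit (R := k) (A := Bang k (A.den V))

section Ext

variable {M : Type*} [AddCommGroup M] [Module k M]

theorem tm_ext {Γ Δ : Ctx α} {f g : (Γ ⨾ Δ).den V →ₗ[k] M} (h : tm.compr₂ f = tm.compr₂ g) :
    f = g :=
  TensorProduct.ext h

theorem un_ext {f g : (Ctx.nil : Ctx α).den V →ₗ[k] M} (h : f (un V) = g (un V)) : f = g :=
  LinearMap.ext_ring h

theorem pr_induction {A B : Formula α} {motive : (A.tensor B).den V → Prop} (x : (A.tensor B).den V)
    (pure : ∀ a b, motive (pr a b)) (add : ∀ x y, motive x → motive y → motive (x + y)) :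
    motive x := by
  induction x using TensorProduct.induction_on with
  | zero =>
    have h : motive (pr 0 0) := pure 0 0
    rw [map_zero] at h
    exact h
  | tmul a b => exact pure a b
  | add x y hx hy => exact add x y hx hy

theorem app_ext {A B : Formula α} {f g : (A.limp B).den V} (h : ∀ a, app f a = app g a) : f = g :=
  LinearMap.ext h

theorem cj_ext {A B : Formula α} {x y : (A.conj B).den V} (h₁ : cfst x = cfst y)
    (h₂ : csnd x = csnd y) : x = y :=
  Prod.ext h₁ h₂

theorem tm_induction {Γ Δ : Ctx α} {motive : (Γ ⨾ Δ).den V → Prop} (x : (Γ ⨾ Δ).den V)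
    (pure : ∀ γ δ, motive (tm γ δ)) (add : ∀ x y, motive x → motive y → motive (x + y)) :
    motive x := by
  induction x using TensorProduct.induction_on with
  | zero =>
    have h : motive (tm 0 0) := pure 0 0
    rw [map_zero] at h
    exact h
  | tmul γ δ => exact pure γ δ
  | add x y hx hy => exact add x y hx hy

end Ext

section Simp

variable {Γ Δ Θ Λ Γ' Δ' : Ctx α} {A B C : Formula α}

@[simp] theorem cfst_cj (a : A.den V) (b : B.den V) : cfst (cj a b) = a := rfl
@[simp] theorem csnd_cj (a : A.den V) (b : B.den V) : csnd (cj a b) = b := rfl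

namespace Exch

@[simp] theorem den_refl (x : Γ.den V) : (refl Γ).den V x = x := rfl
@[simp] theorem den_refl_symm (x : Γ.den V) : ((refl Γ).den V).symm x = x := rfl
@[simp] theorem den_symm (e : Exch Γ Δ) (x : Δ.den V) :
    (symm e).den V x = (e.den V).symm x := rfl
@[simp] theorem den_symm_symm (e : Exch Γ Δ) (x : Γ.den V) :
    ((symm e).den V).symm x = e.den V x := rfl
@[simp] theorem den_trans (e : Exch Γ Δ) (f : Exch Δ Θ) (x : Γ.den V) :
    (trans e f).den V x = f.den V (e.den V x) := rfl
@[simp] theorem den_trans_symm (e : Exch Γ Δ) (f : Exch Δ Θ) (x : Θ.den V) :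
    ((trans e f).den V).symm x = (e.den V).symm ((f.den V).symm x) := rfl
@[simp] theorem den_join (e : Exch Γ Γ') (f : Exch Δ Δ') (x : Γ.den V) (y : Δ.den V) :
    (join e f).den V (tm x y) = tm (e.den V x) (f.den V y) := rfl
@[simp] theorem den_join_symm (e : Exch Γ Γ') (f : Exch Δ Δ') (x : Γ'.den V) (y : Δ'.den V) :
    ((join e f).den V).symm (tm x y) = tm ((e.den V).symm x) ((f.den V).symm y) := rfl
@[simp] theorem den_comm (x : Γ.den V) (y : Δ.den V) :
    (comm Γ Δ).den V (tm x y) = tm y x := rfl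
@[simp] theorem den_comm_symm (x : Γ.den V) (y : Δ.den V) :
    ((comm Γ Δ).den V).symm (tm y x) = tm x y := rfl
@[simp] theorem den_assoc (x : Γ.den V) (y : Δ.den V) (z : Θ.den V) :
    (assoc Γ Δ Θ).den V (tm (tm x y) z) = tm x (tm y z) := rfl
@[simp] theorem den_assoc_symm (x : Γ.den V) (y : Δ.den V) (z : Θ.den V) :
    ((assoc Γ Δ Θ).den V).symm (tm x (tm y z)) = tm (tm x y) z := rfl
@[simp] theorem den_unit (x : Γ.den V) : (unit Γ).den V (tm (un V) x) = x :=
  one_smul k x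
@[simp] theorem den_unit_symm (x : Γ.den V) : ((unit Γ).den V).symm x = tm (un V) x := rfl
@[simp] theorem den_runit (x : Γ.den V) : (runit Γ).den V (tm x (un V)) = x := by
  simp [runit]
@[simp] theorem den_runit_symm (x : Γ.den V) : ((runit Γ).den V).symm x = tm x (un V) := by
  simp [runit]
@[simp] theorem den_lcomm (x : Γ.den V) (y : Δ.den V) (z : Θ.den V) :
    (lcomm Γ Δ Θ).den V (tm x (tm y z)) = tm y (tm x z) := by
  simp [lcomm]
@[simp] theorem den_lcomm_symm (x : Γ.den V) (y : Δ.den V) (z : Θ.den V) :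
    ((lcomm Γ Δ Θ).den V).symm (tm y (tm x z)) = tm x (tm y z) := by
  simp [lcomm]
@[simp] theorem den_lcomm₂ (x : Γ.den V) (y : Δ.den V) (z : Θ.den V) (w : Λ.den V) :
    (lcomm₂ Γ Δ Θ Λ).den V (tm x (tm y (tm z w))) = tm z (tm x (tm y w)) := by
  simp [lcomm₂]
@[simp] theorem den_lcomm₂_symm (x : Γ.den V) (y : Δ.den V) (z : Θ.den V) (w : Λ.den V) :
    ((lcomm₂ Γ Δ Θ Λ).den V).symm (tm z (tm x (tm y w))) = tm x (tm y (tm z w)) := by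
  simp [lcomm₂]
@[simp] theorem den_assoc₂ (x : Γ.den V) (y : Δ.den V) (z : Θ.den V) (w : Λ.den V) :
    (assoc₂ Γ Δ Θ Λ).den V (tm (tm x (tm y z)) w) = tm x (tm y (tm z w)) := by
  simp [assoc₂]
@[simp] theorem den_assoc₂_symm (x : Γ.den V) (y : Δ.den V) (z : Θ.den V) (w : Λ.den V) :
    ((assoc₂ Γ Δ Θ Λ).den V).symm (tm x (tm y (tm z w))) = tm (tm x (tm y z)) w := by
  simp [assoc₂]

end Exch

namespace Proof

@[simp] theorem den_ax (a : A.den V) : (ax A).den V (sg a) = a := rfl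
@[simp] theorem den_exch (e : Exch Γ Δ) (p : Proof Γ A) (x : Δ.den V) :
    (exch e p).den V x = p.den V ((e.den V).symm x) := rfl
@[simp] theorem den_cut (p : Proof Γ A) (q : Proof (A ∷ Δ) B) (x : Γ.den V) (y : Δ.den V) :
    (cut p q).den V (tm x y) = q.den V (tm (sg (p.den V x)) y) := rfl
@[simp] theorem den_tensorR (p : Proof Γ A) (q : Proof Δ B) (x : Γ.den V) (y : Δ.den V) :
    (tensorR p q).den V (tm x y) = pr (p.den V x) (q.den V y) := rfl
@[simp] theorem den_tensorL (p : Proof (A ∷ B ∷ Γ) C) (a : A.den V) (b : B.den V) (x : Γ.den V) :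
    (tensorL p).den V (tm (sg (pr a b)) x) = p.den V (tm (sg a) (tm (sg b) x)) := rfl
@[simp] theorem den_conjR (p : Proof Γ A) (q : Proof Γ B) (x : Γ.den V) :
    (conjR p q).den V x = cj (p.den V x) (q.den V x) := rfl
@[simp] theorem den_conjL₁ (p : Proof (A ∷ Γ) C) (a : (A.conj B).den V) (x : Γ.den V) :
    (conjL₁ B p).den V (tm (sg a) x) = p.den V (tm (sg (cfst a)) x) := rfl
@[simp] theorem den_conjL₂ (p : Proof (B ∷ Γ) C) (a : (A.conj B).den V) (x : Γ.den V) :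
    (conjL₂ A p).den V (tm (sg a) x) = p.den V (tm (sg (csnd a)) x) := rfl
@[simp] theorem den_limpR (p : Proof (A ∷ Γ) B) (a : A.den V) (x : Γ.den V) :
    app ((limpR p).den V x) a = p.den V (tm (sg a) x) := rfl
@[simp] theorem den_limpL (p : Proof Γ A) (q : Proof (B ∷ Δ) C) (f : (A.limp B).den V)
    (x : Γ.den V) (y : Δ.den V) :
    (limpL p q).den V (tm (sg f) (tm x y)) = q.den V (tm (sg (app f (p.den V x))) y) := rfl
@[simp] theorem den_der (p : Proof (A ∷ Γ) B) (a : A.bang.den V) (x : Γ.den V) :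
    (der p).den V (tm (sg a) x) = p.den V (tm (sg (derB a)) x) := rfl
@[simp] theorem den_ctr (p : Proof (A.bang ∷ A.bang ∷ Γ) B) (a : A.bang.den V) (x : Γ.den V) :
    (ctr p).den V (tm (sg a) x) = p.den V ((Exch.assoc _ _ _).den V (tm (dup a) x)) := rfl
@[simp] theorem den_wk (p : Proof Γ B) (a : A.bang.den V) (x : Γ.den V) :
    (wk A p).den V (tm (sg a) x) = epsB a • p.den V x :=
  (p.den V).map_smul _ _

end Proof

end Simp

/-! ### Exchanges act through permutations -/

variable (V) in
/-- The pure tensor in `⟦Γ⟧` with the vector `t i A` at each position `i` with formula `A`. -/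
noncomputable def pureTensor : (Γ : Ctx α) → (Γ.Pos → ∀ A : Formula α, A.den V) → Γ.den V
  | .nil, _ => un V
  | .single A, t => sg (t () A)
  | .join Γ Δ, t => tm (pureTensor Γ fun i => t (.inl i)) (pureTensor Δ fun i => t (.inr i))

/-- Linear maps that agree on pure tensors are equal. -/
theorem pureTensor_ext {M : Type u} [AddCommGroup M] [Module k M] {Γ : Ctx α}
    {f g : Γ.den V →ₗ[k] M} (h : ∀ t, f (pureTensor V Γ t) = g (pureTensor V Γ t)) : f = g := by
  induction Γ generalizing M with
  | nil => exact un_ext (h nofun)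
  | single A =>
    classical
    refine LinearMap.ext fun a => ?_
    let t : ∀ B : Formula α, B.den V := Function.update (fun _ => 0) A a
    have ht : t A = a := Function.update_self ..
    have := h fun _ => t
    rw [pureTensor, ht] at this
    exact this
  | join Γ Δ hΓ hΔ =>
    refine tm_ext (hΓ fun s => hΔ fun t => ?_)
    exact h (Sum.elim s t)

theorem Exch.den_pureTensor {Γ Δ : Ctx α} (e : Exch Γ Δ) (t : Γ.Pos → ∀ A : Formula α, A.den V) :
    e.den V (pureTensor V Γ t) = pureTensor V Δ (t ∘ e.perm.symm) := by
  induction e with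
  | refl Γ => rfl
  | symm e ih =>
    rw [Exch.den_symm, LinearEquiv.symm_apply_eq, ih]
    congr 1
    ext i
    simp [Exch.perm]
  | trans e f ihe ihf => rw [Exch.den_trans, ihe, ihf]; rfl
  | join e f ihe ihf => simp only [pureTensor, Exch.den_join, ihe, ihf]; rfl
  | comm Γ Δ => rfl
  | assoc Γ Δ Θ => rfl
  | unit Γ => exact one_smul k _

theorem Exch.den_eq_of_perm_eq {Γ Δ : Ctx α} {e f : Exch Γ Δ} (h : e.perm = f.perm) :
    e.den V = f.den V := by
  refine LinearEquiv.toLinearMap_injective (pureTensor_ext fun t => ?_)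
  simp only [LinearEquiv.coe_coe, Exch.den_pureTensor, h]

end Calculus

section BangContexts

variable {k : Type u} [Field k] {α : Type w} {V : α → ModuleCat.{u} k}

/-! ### The coalgebras denoted by contexts of exponentials -/

variable (V) in
theorem isCocomm_bang : (Γ : Ctx α) → IsCocomm k (Γ.bang.den V)
  | .nil => inferInstanceAs (IsCocomm k k)
  | .single A => inferInstanceAs (IsCocomm k (Bang k (A.den V)))
  | .join Γ Δ => by
    have := isCocomm_bang Γ
    have := isCocomm_bang Δ
    exact inferInstanceAs (IsCocomm k (Γ.bang.den V ⊗[k] Δ.bang.den V))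

variable (V) in
theorem coderivGenerated_bang_den : (Γ : Ctx α) → CoderivGenerated k (Γ.bang.den V)
  | .nil => coderivGenerated_self
  | .single A => coderivGenerated_bang (V := A.den V)
  | .join Γ Δ => (coderivGenerated_bang_den Γ).tensorProduct (coderivGenerated_bang_den Δ)

instance (Γ : Ctx α) : IsCocomm k (Γ.bang.den V) := isCocomm_bang V Γ

/-- The comultiplication `⟦!Γ⟧ → ⟦!Γ, !Γ⟧`. -/
noncomputable def dupCtx {Γ : Ctx α} : Γ.bang.den V →ₗ[k] (Γ.bang ⨾ Γ.bang).den V :=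
  comul (R := k) (A := Γ.bang.den V)

/-- The counit `⟦!Γ⟧ → k`. -/
noncomputable def epsCtx {Γ : Ctx α} : Γ.bang.den V →ₗ[k] k :=
  counit (R := k) (A := Γ.bang.den V)

/-- The counit of `⟦!(Γ, Δ)⟧`, on `⟦!Γ, !Δ⟧`. -/
noncomputable def epsJoin {Γ Δ : Ctx α} : (Γ.bang ⨾ Δ.bang).den V →ₗ[k] k :=
  epsCtx (Γ := Γ ⨾ Δ)

/-- The comultiplication of `⟦!(Γ, Δ)⟧`, on `⟦!Γ, !Δ⟧`. -/
noncomputable def dupJoin {Γ Δ : Ctx α} :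
    (Γ.bang ⨾ Δ.bang).den V →ₗ[k] ((Γ.bang ⨾ Δ.bang) ⨾ (Γ.bang ⨾ Δ.bang)).den V :=
  dupCtx (Γ := Γ ⨾ Δ)

variable (V) in
/-- The counit of the denotation of the empty context. -/
noncomputable def epsNil : (Ctx.nil : Ctx α).den V →ₗ[k] k := epsCtx (Γ := .nil)

variable (V) in
/-- The comultiplication of the denotation of the empty context. -/
noncomputable def dupNil : (Ctx.nil : Ctx α).den V →ₗ[k] (Ctx.nil ⨾ Ctx.nil : Ctx α).den V :=
  dupCtx (Γ := .nil)

@[simp]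
theorem epsNil_un : epsNil V (un V) = 1 := rfl

@[simp]
theorem epsJoin_tm {Γ Δ : Ctx α} (x : Γ.bang.den V) (y : Δ.bang.den V) :
    epsJoin (tm x y) = epsCtx x * epsCtx y :=
  (mul_comm _ _ : epsCtx y * epsCtx x = _)

@[simp]
theorem dupNil_un : dupNil V (un V) = tm (un V) (un V) := rfl

/-- The exchange `(Γ, Γ'), (Δ, Δ') → (Γ, Δ), (Γ', Δ')`. -/
def Exch.middle (Γ Γ' Δ Δ' : Ctx α) : Exch ((Γ ⨾ Γ') ⨾ (Δ ⨾ Δ')) ((Γ ⨾ Δ) ⨾ (Γ' ⨾ Δ')) :=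
  ((assoc Γ Γ' (Δ ⨾ Δ')).trans ((refl Γ).join (lcomm Γ' Δ Δ'))).trans (assoc Γ Δ (Γ' ⨾ Δ')).symm

@[simp]
theorem Exch.den_middle {Γ Γ' Δ Δ' : Ctx α} (a : Γ.den V) (b : Γ'.den V) (c : Δ.den V)
    (d : Δ'.den V) : (middle Γ Γ' Δ Δ').den V (tm (tm a b) (tm c d)) = tm (tm a c) (tm b d) := by
  simp [middle]

theorem dupJoin_tm {Γ Δ : Ctx α} (x : Γ.bang.den V) (y : Δ.bang.den V) :
    dupJoin (tm x y) = (Exch.middle _ _ _ _).den V (tm (dupCtx x) (dupCtx y)) := by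
  let f : ((Γ.bang ⨾ Γ.bang) ⨾ (Δ.bang ⨾ Δ.bang)).den V →ₗ[k]
      ((Γ.bang ⨾ Δ.bang) ⨾ (Γ.bang ⨾ Δ.bang)).den V :=
    (TensorProduct.AlgebraTensorModule.tensorTensorTensorComm k k k k (Γ.bang.den V)
      (Γ.bang.den V) (Δ.bang.den V) (Δ.bang.den V)).toLinearMap
  have h : f = ((Exch.middle _ _ _ _).den V).toLinearMap := by
    refine pureTensor_ext fun t => ?_
    simp only [pureTensor, LinearEquiv.coe_coe, Exch.den_middle]
    rfl
  exact LinearMap.congr_fun h _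

/-- The comultiplication of `⟦!Γ⟧` is cocommutative. -/
theorem comm_dupCtx {Γ : Ctx α} (x : Γ.bang.den V) :
    (Exch.comm _ _).den V (dupCtx x) = dupCtx x :=
  comm_comul k (A := Γ.bang.den V) x

namespace Proof

variable {Γ Δ : Ctx α} {A B : Formula α}

theorem den_wkCtx (p : Proof Δ B) (x : Γ.bang.den V) (y : Δ.den V) :
    (wkCtx Γ p).den V (tm x y) = epsCtx x • p.den V y := by
  induction Γ generalizing Δ with
  | nil =>
    suffices h : (exch (Exch.unit Δ).symm p).den V ∘ₗ tm.flip y =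
        (epsNil V).smulRight (p.den V y) from LinearMap.congr_fun h x
    refine un_ext ?_
    simp
  | single A => exact den_wk p x y
  | join Γ Γ' ih ih' =>
    suffices h : (exch (Exch.assoc Γ.bang Γ'.bang Δ).symm (wkCtx Γ (wkCtx Γ' p))).den V ∘ₗ
        tm.flip y = epsJoin.smulRight (p.den V y) from LinearMap.congr_fun h x
    refine tm_ext (LinearMap.ext₂ fun a b => ?_)
    simp [ih, ih', smul_smul]

theorem den_ctrCtx (p : Proof (Γ.bang ⨾ (Γ.bang ⨾ Δ)) B) (x : Γ.bang.den V) (y : Δ.den V) :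
    (ctrCtx Γ p).den V (tm x y) = p.den V ((Exch.assoc _ _ _).den V (tm (dupCtx x) y)) := by
  induction Γ generalizing Δ with
  | nil =>
    suffices h : ∀ p : Proof (.nil ⨾ (.nil ⨾ Δ)) B, (exch (Exch.unit (.nil ⨾ Δ)) p).den V ∘ₗ
        tm.flip y = (p.den V ∘ₗ ((Exch.assoc _ _ _).den V).toLinearMap) ∘ₗ tm.flip y ∘ₗ
          dupNil V from LinearMap.congr_fun (h p) x
    intro p
    refine un_ext ?_
    simp
  | single A => exact den_ctr p x y
  | join Γ Γ' ih ih' =>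
    suffices h : ∀ p : Proof ((Γ.bang ⨾ Γ'.bang) ⨾ (Γ.bang ⨾ Γ'.bang) ⨾ Δ) B, (exch
      ((Exch.lcomm Γ'.bang Γ.bang Δ).trans (Exch.assoc Γ.bang Γ'.bang Δ).symm)
      (ctrCtx Γ' (exch
        ((Exch.lcomm Γ.bang Γ'.bang (Γ'.bang ⨾ Δ)).trans
          ((Exch.refl Γ'.bang).join (Exch.lcomm Γ.bang Γ'.bang Δ)))
        (ctrCtx Γ (exch
          ((Exch.assoc Γ.bang Γ'.bang ((Γ.bang ⨾ Γ'.bang) ⨾ Δ)).trans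
            ((Exch.refl Γ.bang).join (((Exch.refl Γ'.bang).join (Exch.assoc Γ.bang Γ'.bang Δ)).trans
              (Exch.lcomm Γ'.bang Γ.bang (Γ'.bang ⨾ Δ))))) p))))).den V ∘ₗ tm.flip y =
      (p.den V ∘ₗ ((Exch.assoc _ _ _).den V).toLinearMap) ∘ₗ tm.flip y ∘ₗ dupJoin from
      LinearMap.congr_fun (h p) x
    intro p
    refine tm_ext (LinearMap.ext₂ fun a b => ?_)
    simp only [LinearMap.compr₂_apply, LinearMap.comp_apply, LinearMap.flip_apply, den_exch,
      Exch.den_trans_symm, Exch.den_symm_symm, Exch.den_assoc, Exch.den_lcomm_symm, ih',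
      dupJoin_tm, LinearEquiv.coe_coe]
    generalize dupCtx b = t
    induction t using tm_induction with
    | add a b ha hb => simp only [map_add, LinearMap.add_apply, ha, hb]
    | pure c d =>
      simp only [Exch.den_assoc, Exch.den_lcomm_symm, Exch.den_join_symm, Exch.den_refl_symm, ih]
      generalize dupCtx a = s
      induction s using tm_induction with
      | add a b ha hb => simp only [map_add, LinearMap.add_apply, ha, hb]
      | pure a b => simp

end Proof
end BangContexts

/-! ### Invariance under cut-elimination -/

section Soundness

variable {k : Type u} [Field k] {α : Type w} {V : α → ModuleCat.{u} k}

/-- The tensor product of linear maps between denotations of contexts. -/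
noncomputable def mapTm {Γ Δ Γ' Δ' : Ctx α} (f : Γ.den V →ₗ[k] Γ'.den V)
    (g : Δ.den V →ₗ[k] Δ'.den V) : (Γ ⨾ Δ).den V →ₗ[k] (Γ' ⨾ Δ').den V :=
  TensorProduct.map f g

@[simp]
theorem mapTm_tm {Γ Δ Γ' Δ' : Ctx α} (f : Γ.den V →ₗ[k] Γ'.den V) (g : Δ.den V →ₗ[k] Δ'.den V)
    (x : Γ.den V) (y : Δ.den V) : mapTm f g (tm x y) = tm (f x) (g y) := rfl

/-- The symmetry of the tensor product as a morphism of coalgebras. -/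
noncomputable def commCoalgHom (k C D : Type*) [Field k] [AddCommGroup C] [Module k C]
    [Coalgebra k C] [AddCommGroup D] [Module k D] [Coalgebra k D] : C ⊗[k] D →ₗc[k] D ⊗[k] C where
  __ := (TensorProduct.comm k C D).toLinearMap
  counit_comp := by
    ext x y
    simp [mul_comm]
  map_comp_comul := by
    refine TensorProduct.ext' fun x y => ?_
    simp only [LinearMap.comp_apply, TensorProduct.comul_tmul, LinearEquiv.coe_coe,
      TensorProduct.comm_tmul]
    generalize comul (R := k) x = s
    generalize comul (R := k) y = t
    induction s with
    | zero => simp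
    | add a b ha hb => simp only [map_add, TensorProduct.add_tmul, TensorProduct.tmul_add, ha, hb]
    | tmul a b =>
      induction t with
      | zero => simp
      | add a b ha hb =>
        simp only [map_add, TensorProduct.add_tmul, TensorProduct.tmul_add, ha, hb]
      | tmul c d => simp

namespace Proof

/-- Exchanges of exponentials denote isomorphisms of coalgebras. -/
theorem exists_coalgHom_exch {Γ Δ : Ctx α} (e : Exch Γ Δ) :
    (∃ Φ : Γ.bang.den V →ₗc[k] Δ.bang.den V, ∀ x, Φ x = e.bang.den V x) ∧
      ∃ Φ : Δ.bang.den V →ₗc[k] Γ.bang.den V, ∀ x, Φ x = (e.bang.den V).symm x := by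
  induction e with
  | refl Γ => exact ⟨⟨CoalgHom.id k _, fun _ => rfl⟩, ⟨CoalgHom.id k _, fun _ => rfl⟩⟩
  | symm e ih => exact ⟨ih.2, ih.1⟩
  | trans e f ihe ihf =>
    obtain ⟨⟨Φ, hΦ⟩, ⟨Φ', hΦ'⟩⟩ := ihe
    obtain ⟨⟨Ψ, hΨ⟩, ⟨Ψ', hΨ'⟩⟩ := ihf
    refine ⟨⟨Ψ.comp Φ, fun x => ?_⟩, ⟨Φ'.comp Ψ', fun x => ?_⟩⟩
    · rw [CoalgHom.comp_apply, hΦ, hΨ]; rfl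
    · rw [CoalgHom.comp_apply, hΨ', hΦ']; rfl
  | @join Γ Γ' Δ Δ' e f ihe ihf =>
    obtain ⟨⟨Φ, hΦ⟩, ⟨Φ', hΦ'⟩⟩ := ihe
    obtain ⟨⟨Ψ, hΨ⟩, ⟨Ψ', hΨ'⟩⟩ := ihf
    have h1 : Φ.toLinearMap = (e.bang.den V).toLinearMap := LinearMap.ext hΦ
    have h2 : Ψ.toLinearMap = (f.bang.den V).toLinearMap := LinearMap.ext hΨ
    have h3 : Φ'.toLinearMap = (e.bang.den V).symm.toLinearMap := LinearMap.ext hΦ'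
    have h4 : Ψ'.toLinearMap = (f.bang.den V).symm.toLinearMap := LinearMap.ext hΨ'
    refine ⟨⟨Coalgebra.TensorProduct.map Φ Ψ, fun x => ?_⟩,
      ⟨Coalgebra.TensorProduct.map Φ' Ψ', fun x => ?_⟩⟩
    · change TensorProduct.map Φ.toLinearMap Ψ.toLinearMap x = _
      rw [h1, h2]; rfl
    · change TensorProduct.map Φ'.toLinearMap Ψ'.toLinearMap x = _
      rw [h3, h4]; rfl
  | comm Γ Δ =>
    exact ⟨⟨commCoalgHom k (Γ.bang.den V) (Δ.bang.den V), fun _ => rfl⟩,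
      ⟨commCoalgHom k (Δ.bang.den V) (Γ.bang.den V), fun _ => rfl⟩⟩
  | assoc Γ Δ Θ =>
    exact ⟨⟨(Coalgebra.TensorProduct.assoc k k (Γ.bang.den V) (Δ.bang.den V)
        (Θ.bang.den V)).toCoalgHom, fun _ => rfl⟩,
      ⟨(Coalgebra.TensorProduct.assoc k k (Γ.bang.den V) (Δ.bang.den V)
        (Θ.bang.den V)).symm.toCoalgHom, fun _ => rfl⟩⟩
  | unit Γ =>
    exact ⟨⟨(Coalgebra.TensorProduct.lid k (Γ.bang.den V)).toCoalgHom, fun _ => rfl⟩,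
      ⟨(Coalgebra.TensorProduct.lid k (Γ.bang.den V)).symm.toCoalgHom, fun _ => rfl⟩⟩

variable [CharZero k]

section Promotion

variable {Γ Δ : Ctx α} {A B : Formula α}

/-- The denotation of a promotion is characterized by the universal property. -/
theorem den_prom_eq (p : Proof Γ.bang A) (Ψ : Γ.bang.den V →ₗc[k] Bang k (A.den V))
    (h : ∀ x, bangCounit k _ (Ψ x) = p.den V x) : (prom p).den V = Ψ.toLinearMap :=
  (coderivGenerated_bang_den V Γ).eq_cofreeLift Ψ (LinearMap.ext h)

theorem exists_coalgHom_prom (p : Proof Γ.bang A) :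
    ∃ Φ : Γ.bang.den V →ₗc[k] Bang k (A.den V), Φ.toLinearMap = (prom p).den V ∧
      ∀ x, bangCounit k _ (Φ x) = p.den V x := by
  obtain ⟨Φ, h1, h2⟩ := (coderivGenerated_bang_den V Γ).exists_cofreeLift (p.den V)
  exact ⟨Φ, h1, LinearMap.congr_fun h2⟩

theorem derB_den_prom (p : Proof Γ.bang A) (x : Γ.bang.den V) :
    derB ((prom p).den V x) = p.den V x := by
  obtain ⟨Φ, h1, h2⟩ := exists_coalgHom_prom (V := V) p
  rw [← h1]
  exact h2 x

theorem epsB_den_prom (p : Proof Γ.bang A) (x : Γ.bang.den V) :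
    epsB ((prom p).den V x) = epsCtx x := by
  obtain ⟨Φ, h1, h2⟩ := exists_coalgHom_prom (V := V) p
  rw [← h1]
  exact CoalgHomClass.counit_comp_apply Φ x

theorem dup_den_prom (p : Proof Γ.bang A) (x : Γ.bang.den V) :
    dup ((prom p).den V x) =
      mapTm (sg ∘ₗ (prom p).den V) (sg ∘ₗ (prom p).den V) (dupCtx x) := by
  obtain ⟨Φ, h1, h2⟩ := exists_coalgHom_prom (V := V) p
  rw [← h1]
  exact (CoalgHomClass.map_comp_comul_apply Φ x).symm

end Promotion

/-- Denotations are invariant under cut-elimination. -/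
theorem CutEq.den_eq {Γ : Ctx α} {A : Formula α} {p q : Proof Γ A} (h : CutEq p q) :
    p.den V = q.den V := by
  induction h with
  | refl => rfl
  | symm _ ih => exact ih.symm
  | trans _ _ ih₁ ih₂ => exact ih₁.trans ih₂
  | congr_exch e _ ih => simp only [den, ih]
  | congr_cut _ _ ih₁ ih₂ => simp only [den, ih₁, ih₂]
  | congr_tensorR _ _ ih₁ ih₂ => simp only [den, ih₁, ih₂]; rfl
  | congr_tensorL _ ih => simp only [den, ih]
  | congr_conjR _ _ ih₁ ih₂ => simp only [den, ih₁, ih₂]; rfl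
  | congr_conjL₁ _ ih => simp only [den, ih]
  | congr_conjL₂ _ ih => simp only [den, ih]
  | congr_limpR _ ih => simp only [den, ih]; rfl
  | congr_limpL _ _ ih₁ ih₂ => simp only [den, ih₁, ih₂]
  | congr_der _ ih => simp only [den, ih]
  | congr_prom _ ih => simp only [den, ih]; rfl
  | congr_ctr _ ih => simp only [den, ih]
  | congr_wk _ ih => simp only [den, ih]
  | exch_perm e f h p => simp only [den, Exch.den_eq_of_perm_eq h]
  | exch_refl p => rfl
  | exch_exch e f p => rfl
  | exch_cut e f p q | exch_tensorR e f p q | exch_conjR e p q | exch_conjL₁ e p | exch_conjL₂ e p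
  | exch_limpL e f p q | exch_der e p | exch_wk e p | cut_ax_left q | cut_ax_right p | cut_cut p q r
  | cut_cut_comm p q r | cut_tensor p q r | cut_conj₁ p q r | cut_conj₂ p q r | cut_limp p q r
  | cut_conjL₁_left p q | cut_conjL₂_left p q | cut_limpL_left p p' q | cut_der_left p q
  | cut_wk_left p q | cut_tensorR_right₁ p q q' | cut_tensorR_right₂ p q q'
  | cut_conjR_right p q q' | cut_conjL₁_right p q | cut_conjL₂_right p q
  | cut_limpL_right₁ p q q' | cut_limpL_right₂ p q q' | cut_der_right p q | cut_wk_right p q =>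
    refine pureTensor_ext fun t => ?_
    simp [pureTensor]
  | exch_tensorL e p =>
    refine pureTensor_ext fun t => ?_
    simp only [pureTensor]
    generalize t (Sum.inl ()) (Formula.tensor _ _) = z
    induction z using pr_induction with
    | pure a b => simp
    | add x y hx hy => simp only [map_add, LinearMap.add_apply, hx, hy]
  | cut_tensorL_left p q =>
    refine pureTensor_ext fun t => ?_
    simp only [pureTensor]
    generalize t (Sum.inl (Sum.inl ())) (Formula.tensor _ _) = z
    induction z using pr_induction with
    | pure a b => simp
    | add x y hx hy => simp only [map_add, LinearMap.add_apply, hx, hy]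
  | cut_tensorL_right p q =>
    refine pureTensor_ext fun t => ?_
    simp only [pureTensor]
    generalize t (Sum.inr (Sum.inl ())) (Formula.tensor _ _) = z
    induction z using pr_induction with
    | pure a b => simp
    | add x y hx hy => simp only [map_add, LinearMap.add_apply, hx, hy]
  | exch_limpR e p | cut_limpR_right p q =>
    refine pureTensor_ext fun t => app_ext fun a => ?_
    simp [pureTensor]
  | exch_prom e p =>
    obtain ⟨Φ, h1, h2⟩ := exists_coalgHom_prom (V := V) p
    obtain ⟨Ψ, hΨ⟩ := (exists_coalgHom_exch (V := V) e).2
    refine (den_prom_eq _ (Φ.comp Ψ) fun x => ?_).trans (LinearMap.ext fun x => ?_)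
    · rw [CoalgHom.comp_apply, h2, hΨ, den_exch]
    · change Φ (Ψ x) = (prom p).den V ((e.bang.den V).symm x)
      rw [hΨ]
      exact LinearMap.congr_fun h1 _
  | exch_ctr e p =>
    refine pureTensor_ext fun t => ?_
    simp [pureTensor]
    generalize dup (V := V) _ = z
    induction z using tm_induction with
    | pure a b => simp
    | add x y hx hy => simp only [map_add, LinearMap.add_apply, hx, hy]
  | cut_ctr_left p q =>
    refine pureTensor_ext fun t => ?_
    simp [pureTensor]
    generalize dup (V := V) _ = z
    induction z using tm_induction with
    | pure a b => simp
    | add x y hx hy => simp only [map_add, LinearMap.add_apply, hx, hy]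
  | cut_ctr_right p q =>
    refine pureTensor_ext fun t => ?_
    simp [pureTensor]
    generalize dup (V := V) _ = z
    induction z using tm_induction with
    | pure a b => simp
    | add x y hx hy => simp only [map_add, LinearMap.add_apply, hx, hy]
  | cut_prom_der p q =>
    refine tm_ext (LinearMap.ext₂ fun x y => ?_)
    simp [derB_den_prom]
  | cut_prom_wk p q =>
    refine tm_ext (LinearMap.ext₂ fun x y => ?_)
    simp [epsB_den_prom, den_wkCtx]
  | cut_prom_ctr p q =>
    refine tm_ext (LinearMap.ext₂ fun x y => ?_)
    simp only [LinearMap.compr₂_apply, den_cut, den_ctr, den_ctrCtx, dup_den_prom]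
    -- the two copies of the promotion are cut in the opposite order, hence cocommutativity
    conv_lhs => rw [← comm_dupCtx x]
    generalize dupCtx x = z
    induction z using tm_induction with
    | pure a b => simp
    | add x y hx hy => simp only [map_add, LinearMap.add_apply, hx, hy]
  | cut_prom_prom p q =>
    obtain ⟨Φ, h1, h2⟩ := exists_coalgHom_prom (V := V) p
    obtain ⟨Ψ, h3, h4⟩ := exists_coalgHom_prom (V := V) q
    refine Eq.symm ((den_prom_eq _ (Ψ.comp (Coalgebra.TensorProduct.map Φ (CoalgHom.id k _)))
      fun x => ?_).trans ?_)
    · refine (h4 _).trans ?_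
      exact congrArg (fun f => q.den V (TensorProduct.map f LinearMap.id x)) h1
    · refine LinearMap.ext fun x => (LinearMap.congr_fun h3 _).trans ?_
      exact congrArg (fun f => (prom q).den V (TensorProduct.map f LinearMap.id x)) h1
  | eta_tensor A B =>
    refine pureTensor_ext fun t => ?_
    simp only [pureTensor]
    generalize t () (Formula.tensor _ _) = z
    induction z using pr_induction with
    | pure a b => simp
    | add x y hx hy => simp only [map_add, hx, hy]
  | eta_conj A B =>
    refine pureTensor_ext fun t => cj_ext ?_ ?_ <;> simp [pureTensor]
  | eta_limp A B =>
    refine pureTensor_ext fun t => app_ext fun a => ?_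
    simp [pureTensor]
  | eta_bang A =>
    refine (den_prom_eq (Γ := .single A) _ (CoalgHom.id k _) fun x => ?_).symm
    have h : ∀ a : A.bang.den V, derB a = (exch (Exch.runit _) (der (exch (Exch.runit _).symm
        (ax A)))).den V (sg a) := by
      intro a
      simp
    exact h x

end Proof
end Soundness

/-! ### Weight one error syndromes -/

section Syndromes

variable {k : Type u} [Field k] {α : Type w} {V : α → ModuleCat.{u} k}

/-- The tensor `z ⊗ ⋯ ⊗ z` in `⟦Γ⟧`, where `z` chooses a vector for each formula. -/
noncomputable def baseVec (z : ∀ A : Formula α, A.den V) : (Γ : Ctx α) → Γ.den V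
  | .nil => un V
  | .single A => sg (z A)
  | .join Γ Δ => tm (baseVec z Γ) (baseVec z Δ)

/-- The sum `∑ z ⊗ ⋯ ⊗ o ⊗ ⋯ ⊗ z` in `⟦Γ⟧` over all positions of the factor `o`: the derivative of
`baseVec` at `z` in the direction `o`. -/
noncomputable def tangentVec (z o : ∀ A : Formula α, A.den V) : (Γ : Ctx α) → Γ.den V
  | .nil => 0
  | .single A => sg (o A)
  | .join Γ Δ => tm (tangentVec z o Γ) (baseVec z Δ) + tm (baseVec z Γ) (tangentVec z o Δ)

theorem Exch.den_baseVec (z : ∀ A : Formula α, A.den V) {Γ Δ : Ctx α} (e : Exch Γ Δ) :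
    e.den V (baseVec z Γ) = baseVec z Δ := by
  induction e with
  | refl Γ => rfl
  | symm e ih => rw [Exch.den_symm, LinearEquiv.symm_apply_eq, ih]
  | trans e f ihe ihf => rw [Exch.den_trans, ihe, ihf]
  | join e f ihe ihf => simp only [baseVec, Exch.den_join, ihe, ihf]
  | comm Γ Δ => rfl
  | assoc Γ Δ Θ => rfl
  | unit Γ => simp [baseVec]

theorem Exch.den_tangentVec (z o : ∀ A : Formula α, A.den V) {Γ Δ : Ctx α} (e : Exch Γ Δ) :
    e.den V (tangentVec z o Γ) = tangentVec z o Δ := by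
  induction e with
  | refl Γ => rfl
  | symm e ih => rw [Exch.den_symm, LinearEquiv.symm_apply_eq, ih]
  | trans e f ihe ihf => rw [Exch.den_trans, ihe, ihf]
  | join e f ihe ihf =>
    simp only [tangentVec, map_add, Exch.den_join, ihe, ihf, Exch.den_baseVec]
  | comm Γ Δ => simp [tangentVec, add_comm]
  | assoc Γ Δ Θ => simp [tangentVec, baseVec, add_assoc]
  | unit Γ => simp [tangentVec, baseVec]

/-- A family of vectors `z`, `o` such that `z` at `!A` is group-like over `z` at `A`, and `o` at `!A` is
a tangent vector at it over `o` at `A`. -/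
structure IsTangentAt (A : Formula α) (z o : ∀ A : Formula α, A.den V) : Prop where
  derB_base : derB (z A.bang) = z A
  derB_tangent : derB (o A.bang) = o A
  dup_base : dup (z A.bang) = tm (sg (z A.bang)) (sg (z A.bang))
  dup_tangent : dup (o A.bang) =
    tm (sg (o A.bang)) (sg (z A.bang)) + tm (sg (z A.bang)) (sg (o A.bang))
  epsB_base : epsB (z A.bang) = 1
  epsB_tangent : epsB (o A.bang) = 0

namespace Proof

variable {A B : Formula α} {z o : ∀ A : Formula α, A.den V}

/-- Derelictions preserve the values at `baseVec` and `tangentVec`. -/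
theorem Derelicted.den_eq (h : IsTangentAt A z o) {Γ₀ Γ : Ctx α} {π : Proof Γ₀ B} {p : Proof Γ B}
    (hp : Derelicted (A := A) π p) :
    p.den V (baseVec z Γ) = π.den V (baseVec z Γ₀) ∧
      p.den V (tangentVec z o Γ) = π.den V (tangentVec z o Γ₀) := by
  induction hp with
  | base => exact ⟨rfl, rfl⟩
  | exch e _ ih =>
    rw [← ih.1, ← ih.2, den_exch, den_exch, ← Exch.den_baseVec z e, ← Exch.den_tangentVec z o e]
    simp
  | der _ ih =>
    rw [← ih.1, ← ih.2]
    simp [baseVec, tangentVec, h.derB_base, h.derB_tangent]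

/-- Contractions and weakenings preserve the values at `baseVec` and `tangentVec`. -/
theorem Contracted.den_eq (h : IsTangentAt A z o) {n : ℕ} {Γ : Ctx α} {π : Proof (Ctx.rep A n) B}
    {p : Proof Γ B} (hp : Contracted π p) :
    p.den V (baseVec z Γ) = π.den V (baseVec z _) ∧
      p.den V (tangentVec z o Γ) = π.den V (tangentVec z o _) := by
  induction hp with
  | base hp => exact hp.den_eq h
  | exch e _ ih =>
    rw [← ih.1, ← ih.2, den_exch, den_exch, ← Exch.den_baseVec z e, ← Exch.den_tangentVec z o e]
    simp
  | ctr _ ih =>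
    rw [← ih.1, ← ih.2]
    simp [baseVec, tangentVec, h.dup_base, h.dup_tangent, add_assoc]
  | wk _ _ ih =>
    rw [← ih.1, ← ih.2]
    simp [baseVec, tangentVec, h.epsB_base, h.epsB_tangent]

theorem comul_ket_singleton {V : Type u} [AddCommGroup V] [Module k V] (P v : V) :
    comul (R := k) (ket k P [v]) = ket k P [v] ⊗ₜ ket k P [] + ket k P [] ⊗ₜ ket k P [v] := by
  simp [ket, comul_symIncl]

theorem counit_ket_singleton {V : Type u} [AddCommGroup V] [Module k V] (P v : V) :
    counit (R := k) (ket k P [v]) = 0 := by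
  simp [ket, counit_symIncl]

/-- The vectors `|∅⟩_P` and `|v⟩_P` form a group-like element with a tangent vector, over `P` and `v`. -/
theorem exists_isTangentAt (A : Formula α) (P v : A.den V) :
    ∃ z o : ∀ A : Formula α, A.den V, IsTangentAt A z o ∧ z A = P ∧ o A = v ∧
      z A.bang = ket k P [] ∧ o A.bang = ket k P [v] := by
  classical
  -- values can be prescribed at `A` and at `!A` independently
  have hA : A.bang ≠ A := fun h => by
    have := congrArg sizeOf h
    simp at this
  let fam (a : A.den V) (b : A.bang.den V) : ∀ B : Formula α, B.den V :=
    Function.update (Function.update (fun _ => 0) A a) A.bang b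
  have h1 : ∀ a b, fam a b A = a := fun a b => by
    simp [fam, Function.update_of_ne hA.symm]
  have h2 : ∀ a b, fam a b A.bang = b := fun a b => by simp [fam]
  obtain ⟨b₀, hb₀⟩ : ∃ b : A.bang.den V, b = ket k P [] := ⟨_, rfl⟩
  obtain ⟨b₁, hb₁⟩ : ∃ b : A.bang.den V, b = ket k P [v] := ⟨_, rfl⟩
  rw [← hb₀, ← hb₁]
  refine ⟨fam P b₀, fam v b₁, ⟨?_, ?_, ?_, ?_, ?_, ?_⟩, h1 _ _, h1 _ _, h2 _ _, h2 _ _⟩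
  · rw [h1, h2, hb₀]; exact bangCounit_ket_nil k P
  · rw [h1, h2, hb₁]; exact bangCounit_ket_singleton k P v
  · rw [h2, hb₀]
    exact (isGroupLikeElem_symIncl_one P).comul_eq_tmul_self
  · rw [h2, h2, hb₀, hb₁]
    exact comul_ket_singleton P v
  · rw [h2, hb₀]
    exact (isGroupLikeElem_symIncl_one P).counit_eq_one
  · rw [h2, hb₁]
    exact counit_ket_singleton P v

/-- The tensor of the vectors `x i` in the denotation of `A, …, A`. -/
noncomputable def repVec {A : Formula α} : (n : ℕ) → (Fin n → A.den V) → (Ctx.rep A n).den V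
  | 0, _ => un V
  | n + 1, x => tm (sg (x 0)) (repVec n fun i => x i.succ)

theorem vec_evalLinear {n : ℕ} (π : Proof (Ctx.rep A n) B) (X : Fin n → Proof .nil A) :
    (evalLinear n π X).vec V = π.den V (repVec n fun i => (X i).vec V) := by
  induction n with
  | zero => rfl
  | succ n ih =>
    rw [evalLinear, ih, den_exch, Exch.den_unit_symm]
    rfl

theorem repVec_const (n : ℕ) : repVec n (fun _ => z A) = baseVec z (Ctx.rep A n) := by
  induction n with
  | zero => rfl
  | succ n ih => rw [repVec, ih]; rfl

/-- Multilinearity: the derivative of `repVec` at `P` in the direction `Q - P` is the sum of the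
differences when a single `P` is replaced by `Q`. -/
theorem tangentVec_rep (n : ℕ) (Q : A.den V) (ho : o A = Q - z A) :
    tangentVec z o (Ctx.rep A n) =
      ∑ i, (repVec n (Function.update (fun _ => z A) i Q) - baseVec z (Ctx.rep A n)) := by
  induction n with
  | zero => rfl
  | succ n ih =>
    have h0 : repVec (n + 1) (Function.update (fun _ => z A) 0 Q) =
        tm (sg Q) (baseVec z (Ctx.rep A n)) := by
      rw [repVec, ← repVec_const]
      rfl
    have hs : ∀ i : Fin n, repVec (n + 1) (Function.update (fun _ => z A) i.succ Q) =
        tm (sg (z A)) (repVec n (Function.update (fun _ => z A) i Q)) := by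
      intro i
      rw [repVec]
      congr 2
      ext j
      simp [Function.update_apply]
    rw [Fin.sum_univ_succ, h0]
    simp only [hs, Ctx.rep, tangentVec, baseVec, ih, ho, map_sub, map_sum, LinearMap.sub_apply]
    rfl

/-- The promotion of a proof `ρ` of `⊢ A` denotes `|∅⟩_P` with `P = ⟦ρ⟧`. -/
theorem den_prom_nil [CharZero k] (ρ : Proof .nil A) :
    (prom (Γ := .nil) ρ).den V (un V) = ket k (ρ.vec V) [] := by
  have hg := isGroupLikeElem_symIncl_one (k := k) (ρ.vec V)
  let Ψ : k →ₗc[k] Bang k (A.den V) :=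
    { LinearMap.toSpanSingleton k _ (ket k (ρ.vec V) []) with
      counit_comp := LinearMap.ext_ring (by
        simpa [ket] using hg.counit_eq_one)
      map_comp_comul := LinearMap.ext_ring (by
        simpa [ket] using hg.comul_eq_tmul_self.symm) }
  have h := den_prom_eq (V := V) (Γ := .nil) ρ Ψ (LinearMap.congr_fun (un_ext (f :=
    bangCounit k (A.den V) ∘ₗ Ψ.toLinearMap) (g := ρ.den V) ?_))
  · exact (LinearMap.congr_fun h (1 : k)).trans (one_smul k _)
  · exact (congrArg (bangCounit k (A.den V)) (one_smul k _)).trans (bangCounit_ket_nil k _)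

theorem vec_evalBang [CharZero k] (ψ : Proof (.single A.bang) B) (ρ : Proof .nil A) :
    (ψ.evalBang ρ).vec V = ψ.den V (ket k (ρ.vec V) []) := by
  rw [← den_prom_nil]
  change (ψ.evalBang ρ).den V (un V) = ψ.den V (sg ((prom (Γ := .nil) ρ).den V (un V)))
  rw [evalBang, den_exch, Exch.den_unit_symm]
  refine (den_cut (Γ := .nil) (prom (Γ := .nil) ρ) _ _ _).trans ?_
  simp only [den_exch, Exch.den_symm_symm, Exch.den_runit]
  rfl

theorem CutEq.vec_eq [CharZero k] {σ τ : Proof .nil B} (h : CutEq σ τ) : σ.vec V = τ.vec V :=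
  LinearMap.congr_fun h.den_eq _

/-- The value of a plain proof at `|Q - P⟩_P` is the sum over all weight one error syndromes of the
differences with the error free value. -/
theorem IsPlainWith.den_ket [CharZero k] {n : ℕ} {ψ : Proof (.single A.bang) B}
    {π : Proof (Ctx.rep A n) B} (h : ψ.IsPlainWith π) (ρ₀ ρ₁ : Proof .nil A) :
    ψ.den V (ket k (ρ₀.vec V) [ρ₁.vec V - ρ₀.vec V]) =
      ∑ i, ((evalLinear n π (Function.update (fun _ => ρ₀) i ρ₁)).vec V -
        (ψ.evalBang ρ₀).vec V) := by
  obtain ⟨-, φ, hφ, hψφ⟩ := h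
  obtain ⟨z, o, hzo, hz, ho, hz', ho'⟩ :=
    exists_isTangentAt A (ρ₀.vec V) (ρ₁.vec V - ρ₀.vec V)
  obtain ⟨h0, h1⟩ := hφ.den_eq hzo
  rw [vec_evalBang, hψφ.den_eq, ← hz', ← ho']
  refine h1.trans ?_
  rw [tangentVec_rep n (ρ₁.vec V) (by rw [ho, hz]), map_sum]
  refine Finset.sum_congr rfl fun i _ => ?_
  rw [map_sub, ← h0, vec_evalLinear]
  congr 3
  ext j
  rw [Function.update_apply, Function.update_apply, hz]
  split_ifs <;> rfl

end Proof

end Syndromes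

end LinLog

open LinLog in
open Classical in
theorem mainTheorem5 {k : Type u} [Field k] [IsAlgClosed k] [CharZero k]
    {α : Type w} (V : α → ModuleCat.{u} k) {A B : Formula α} {n : ℕ}
    (ψ : Proof (.single A.bang) B) (π : Proof (Ctx.rep A n) B) (hψ : ψ.IsPlainWith π)
    (ρ₀ ρ₁ : Proof .nil A)
    (Q : Finset (Proof .nil B))
    (hQ : (Q : Set (Proof .nil B)).Pairwise fun σ τ => ¬ Proof.CutEq σ τ)
    (hπ : ∀ X : Fin n → Proof .nil A, (∀ i, X i = ρ₀ ∨ X i = ρ₁) →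
      ∃ τ ∈ Q, Proof.CutEq (Proof.evalLinear n π X) τ) :
    ψ.den V (ket k (ρ₀.vec V) [ρ₁.vec V - ρ₀.vec V]) =
      ∑ τ ∈ Q with ¬ Proof.CutEq τ (ψ.evalBang ρ₀),
        π.weightOneCount ρ₀ ρ₁ τ • (τ.vec V - (ψ.evalBang ρ₀).vec V) := by
  let T (i : Fin n) : Proof .nil B :=
    Proof.evalLinear n π (Function.update (fun _ => ρ₀) i ρ₁)
  have hT : ∀ i, ∃ τ ∈ Q, Proof.CutEq (T i) τ := fun i => hπ _ fun j => by
    rw [Function.update_apply]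
    split_ifs <;> simp
  choose τ hτQ hτ using hT
  have hτ_iff : ∀ i, ∀ σ ∈ Q, Proof.CutEq (T i) σ ↔ τ i = σ := by
    refine fun i σ hσ => ⟨fun h => ?_, fun h => h ▸ hτ i⟩
    by_contra hne
    exact hQ (hτQ i) hσ hne ((hτ i).symm.trans h)
  rw [hψ.den_ket, ← Finset.sum_fiberwise_of_maps_to (t := Q) (g := τ) fun i _ => hτQ i,
    Finset.sum_filter_of_ne]
  · refine Finset.sum_congr rfl fun σ hσ => ?_
    have hcount : π.weightOneCount ρ₀ ρ₁ σ = (Finset.univ.filter fun i => τ i = σ).card := by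
      rw [Proof.weightOneCount, ← Set.ncard_coe_finset]
      congr 1
      ext i
      simpa using hτ_iff i σ hσ
    rw [hcount, ← Finset.sum_const]
    refine Finset.sum_congr rfl fun i hi => ?_
    rw [← (Finset.mem_filter.1 hi).2, ← (hτ i).vec_eq]
  · -- syndromes with the error free outcome contribute `0`
    intro σ _ hne h
    exact hne (by rw [h.vec_eq, sub_self, smul_zero])
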